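/- Let $d\ge 2$ and write $x=(\tilde x,x_d)\in[0,1]^{d-1}\times[0,1]$. A classification problem is a pair $(\mathbb P_X,\eta)$ of a probability measure $\mathbb P_X$ on $[0,1]^d$ and a measurable function $\eta:[0,1]^d\to[0,1]$, with $\mathbb P(Y=1\mid X=x)=\eta(x)$, $Y\in\{0,1\}$. Put $f^*=\mathbf 1\{\eta\ge 1/2\}$, $R(f)=\mathbb P(Y\ne f(X))$ and $\mathcal E(f)=R(f)-R(f^*)$. For $\beta>0$ let $\lfloor\beta\rfloor$ be the largest integer strictly smaller than $\beta$. For $\lambda\ge1$ and $\alpha>0$, $\Sigma(\lambda,\alpha)$ is the set of functions $g:[0,1]^{d-1}\to[0,1]$ that are $\lfloor\alpha\rfloor$ times continuously differentiable and satisfy $|g(x)-\mathrm{TP}_{y,\lfloor\beta\rfloor}(x)|\le\lambda\|x-y\|_\infty^\beta$ for all $x,y\in[0,1]^{d-1}$ and all $0<\beta\le\alpha$, where $\mathrm{TP}_{y,k}$ is the Taylor polynomial of $g$ of degree $k$ at $y$. Let $\lambda\ge 1$, $\alpha>0$, $\kappa>1$, $\kappa'>\kappa-1$, $c>0$, $C_3>0$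 and $0<\Delta_0<1$, with $c\,\max(1/2,\Delta_0)^{\kappa-1}<1/2$ (which always holds if $c\le 1/2$). Let $\mathcal P(\alpha,\kappa,\kappa')$ be the set of classification problems for which there is $g^*\in\Sigma(\lambda,\alpha)$ such that 1. $\{x:\eta(x)\ge 1/2\}=\{x: x_d\ge g^*(\tilde x)\}$; 2. $|\eta(x)-1/2|\ge c\,|x_d-g^*(\tilde x)|^{\kappa-1}$ for all $x\in[0,1]^d$; 3. $\int_{\{x:\,|x_d-g^*(\tilde x)|\le\Delta\}}|1-2\eta(x)|\,d\mathbb P_X(x)\le C_3\Delta^{\kappa'}$ for all $\Delta\in[0,\Delta_0]$. An active strategy $\mathcal A_n$ with budget $n$ sequentially chooses points $x_1,\dots,x_n\in[0,1]^d$, where $x_t$ may depend on the marginal $\mathbb P_X$, on internal randomness and on the points and labels observed before; it receives at each $x_t$ a label drawn from $\mathbb P_{Y\mid X=x_t}$, and finally returns a classifier $\widehat f_n:[0,1]^d\to\{0,1\}$ that depends on the same information. Then there are a constant $C>0$ that does not depend on $n$ and an integer $N$ such that for all $n\ge N$ $$ \inf_{\mathcal A_n}\ \sup_{(\mathbb P_X,\eta)\in\mathcal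 P(\alpha,\kappa,\kappa')}\ \mathbb E\big[\mathcal E(\widehat f_n)\big]\ \ge\ C\,n^{-\alpha\kappa'/(2\alpha(\kappa-1)+d-1)} . $$ -/

import Mathlib

open MeasureTheory ProbabilityTheory Set
open scoped ENNReal

universe u

namespace ActiveLearning

noncomputable section

/-- The feature space `[0,1]^d`, written as `[0,1]^(d-1) × [0,1]`: a point is
`x = (x̃, x_d)`. -/
abbrev Feature (d : ℕ) : Type := (Fin (d - 1) → unitInterval) × unitInterval

/-- The first `d - 1` coordinates `x̃` of a point, as a real vector. -/
def Feature.tilde {d : ℕ} (x : Feature d) : Fin (d - 1) → ℝ := fun i => (x.1 i : ℝ)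

/-- The last coordinate `x_d` of a point, as a real number. -/
def Feature.last {d : ℕ} (x : Feature d) : ℝ := (x.2 : ℝ)

/-! ### Hölder classes and epigraphs -/

/-- For `a > 0`, the largest integer strictly smaller than `a`. -/
def strictFloor (a : ℝ) : ℕ := ⌈a⌉₊ - 1

/-- The Taylor polynomial of degree `k` of `g` at `y`, evaluated at `x`. Derivatives are those
of `g` as a function on the cube `[0,1]^m` (one-sided at its faces). -/
def taylorPoly {m : ℕ} (g : (Fin m → ℝ) → ℝ) (k : ℕ) (y x : Fin m → ℝ) : ℝ :=
  ∑ j ∈ Finset.range (k + 1),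
    ((j.factorial : ℝ))⁻¹ * iteratedFDerivWithin ℝ j g (Icc 0 1) y (fun _ => x - y)

/-- The Hölder class `Σ(lam, α)` of functions `g : [0,1]^m → [0,1]`. Only the values of `g` on
the cube matter. The norm of `Fin m → ℝ` is the maximum norm. -/
structure IsHolder {m : ℕ} (lam α : ℝ) (g : (Fin m → ℝ) → ℝ) : Prop where
  mapsTo : MapsTo g (Icc 0 1) (Icc 0 1)
  contDiffOn : ContDiffOn ℝ (strictFloor α : ℕ) g (Icc 0 1)
  taylor_le : ∀ x ∈ Icc (0 : Fin m → ℝ) 1, ∀ y ∈ Icc (0 : Fin m → ℝ) 1,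
    ∀ β : ℝ, 0 < β → β ≤ α →
      |g x - taylorPoly g (strictFloor β) y x| ≤ lam * ‖x - y‖ ^ β

/-- The epigraph of `g` in `[0,1]^d`. -/
def epi {d : ℕ} (g : (Fin (d - 1) → ℝ) → ℝ) : Set (Feature d) :=
  {x | g x.tilde ≤ x.last}

/-! ### Classification problems -/

/-- A classification problem on `[0,1]^d`, given by the marginal law of `X` and the
regression function `η(x) = P(Y = 1 | X = x)`, defined at every point. -/
structure Problem (d : ℕ) where
  PX : Measure (Feature d)
  isProb : IsProbabilityMeasure PX
  η : Feature d → ℝ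
  measurable_η : Measurable η
  η_mem : ∀ x, η x ∈ Icc (0 : ℝ) 1

/-- The conditional law of the label given `X = x`: Bernoulli with parameter `η x`
(`true` is the label `1`, `false` is the label `0`). -/
def Problem.labelKernel {d : ℕ} (P : Problem d) : Kernel (Feature d) Bool where
  toFun x := ENNReal.ofReal (P.η x) • Measure.dirac true
    + ENNReal.ofReal (1 - P.η x) • Measure.dirac false
  measurable' := by
    refine Measure.measurable_of_measurable_coe _ fun s _ => ?_
    simp only [Measure.coe_add, Measure.coe_smul, Pi.add_apply, Pi.smul_apply, smul_eq_mul]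
    exact (P.measurable_η.ennreal_ofReal.mul_const _).add
      ((measurable_const.sub P.measurable_η).ennreal_ofReal.mul_const _)

/-- The conditional label laws are probability measures (also used to compose kernels). -/
instance Problem.isMarkov_labelKernel {d : ℕ} (P : Problem d) :
    IsMarkovKernel P.labelKernel := by
  refine ⟨fun x => ⟨?_⟩⟩
  have h := P.η_mem x
  change (ENNReal.ofReal (P.η x) • Measure.dirac true
    + ENNReal.ofReal (1 - P.η x) • Measure.dirac false : Measure Bool) univ = 1
  simp only [Measure.coe_add, Measure.coe_smul, Pi.add_apply, Pi.smul_apply, smul_eq_mul,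
    measure_univ, mul_one]
  rw [← ENNReal.ofReal_add h.1 (by linarith [h.2])]
  simp

/-- The joint law of `(X, Y)`. -/
def Problem.joint {d : ℕ} (P : Problem d) : Measure (Feature d × Bool) :=
  P.PX ⊗ₘ P.labelKernel

/-- The 0-1 risk `R(f) = P(Y ≠ f(X))`. -/
def Problem.risk {d : ℕ} (P : Problem d) (f : Feature d → Bool) : ℝ :=
  P.joint.real {z | z.2 ≠ f z.1}

open Classical in
/-- The Bayes classifier `1{η ≥ 1/2}`. -/
def Problem.bayes {d : ℕ} (P : Problem d) (x : Feature d) : Bool :=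
  decide (1 / 2 ≤ P.η x)

/-- The excess risk `R(f) - R(f*)`. -/
def Problem.excessRisk {d : ℕ} (P : Problem d) (f : Feature d → Bool) : ℝ :=
  P.risk f - P.risk P.bayes

/-- The class `P(α, κ, κ')` for fixed constants `lam, c` and `C₃, Δ₀`: the boundary `g` is a
`(lam, α)`-Hölder function, `η` satisfies the geometric noise condition with `c, κ`, and the
excess risk carried by the strip of half-width `Δ` around the boundary is at most `C₃ Δ^κ'`
for all `Δ ∈ [0, Δ₀]`. -/
def problemClass (d : ℕ) (lam α c κ C₃ Δ₀ κ' : ℝ) : Set (Problem d) :=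
  {P | ∃ g : (Fin (d - 1) → ℝ) → ℝ,
    IsHolder lam α g ∧
    {x | 1 / 2 ≤ P.η x} = epi g ∧
    (∀ x : Feature d, c * |x.last - g x.tilde| ^ (κ - 1) ≤ |P.η x - 1 / 2|) ∧
    (∀ Δ ∈ Icc 0 Δ₀,
      ∫ x in {x : Feature d | |x.last - g x.tilde| ≤ Δ}, |1 - 2 * P.η x| ∂P.PX ≤ C₃ * Δ ^ κ')}

/-! ### Active strategies -/

/-- The first `t` queried points with their labels. -/
abbrev History (d t : ℕ) : Type := Fin t → Feature d × Bool

/-- A randomized active strategy on `[0,1]^d`. The seed carries all the internal randomness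
(for instance an unlabelled sample). The point queried after `t` labels depends on the seed and
on the history so far, and after `n` labels a classifier is returned. A strategy that stops
before its budget `n` is spent is covered: it repeats some query and ignores the answers. -/
structure ActiveStrategy (d n : ℕ) where
  Seed : Type u
  mSeed : MeasurableSpace Seed
  seedLaw : Measure Seed
  isProb : IsProbabilityMeasure seedLaw
  query : (t : ℕ) → Seed × History d t → Feature d
  measurable_query : ∀ t, Measurable (query t)
  classify : Seed × History d n → Feature d → Bool
  measurable_classify : Measurable (Function.uncurry classify)

attribute [instance] ActiveStrategy.mSeed

/-- The joint law of the seed and the first `t` queries and labels, when strategy `A` is run on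
problem `P`: each new label is drawn from the conditional law of `Y` at the queried point. -/
def ActiveStrategy.law {d n : ℕ} (A : ActiveStrategy.{u} d n) (P : Problem d) :
    (t : ℕ) → Measure (A.Seed × History d t)
  | 0 => A.seedLaw.map (fun ω => (ω, Fin.elim0))
  | t + 1 =>
    (A.law P t ⊗ₘ P.labelKernel.comap (A.query t) (A.measurable_query t)).map
      (fun p => (p.1.1, Fin.snoc p.1.2 (A.query t p.1, p.2)))

/-- The expected excess risk of the classifier returned by `A` after `n` labels. -/
def ActiveStrategy.expectedExcessRisk {d n : ℕ} (A : ActiveStrategy.{u} d n)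
    (P : Problem d) : ℝ≥0∞ :=
  ∫⁻ h, ENNReal.ofReal (P.excessRisk (A.classify h)) ∂(A.law P n)

/-- The minimax expected excess risk over a class of problems with `n` labels. The learner may
also know the marginal law of `X`: a strategy is chosen for each marginal law. In particular,
strategies that sample from the marginal law are included. -/
def minimaxRisk {d : ℕ} (n : ℕ) (Q : Set (Problem d)) : ℝ≥0∞ :=
  ⨅ A : Measure (Feature d) → ActiveStrategy.{u} d n,
    ⨆ P ∈ Q, (A P.PX).expectedExcessRisk P

end

end ActiveLearning

/-! The proof is a hypercube (Assouad) argument adapted to sequential queries. Divide `[0,1]^(d-1)`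
into `K^(d-1)` cells and let the boundary be a level `b` plus one bump of height `±h` per cell, with
independent signs `σ`. Bumps have disjoint supports, so `h` of order `K^(-α)` keeps every boundary
in the Hölder class (`isHolder_bumpBoundary`).

The regression function is `1/2 ± c (|x_d - b| + 2h)^(κ-1)`. Its distance to `1/2` does not depend
on `σ`; only the side does. Flipping one sign thus changes labels only in one column and only at
heights within `h` of `b`, where the margin is at most `c (3h)^(κ-1)`. A query there loses at most
`4 (c (3h)^(κ-1))^2` of Hellinger affinity, and a query elsewhere loses nothing
(`GridParam.le_affinity`, `GridParam.one_le_affinity_of_notMem_column`).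

The marginal puts mass `w` uniformly on the points at height `b` over the cell centres, and the rest
at the origin. It is the same for all `σ`, so knowing it does not help. Each grid point is at
distance exactly `h` from the boundary, on the side given by the sign. The mass is tuned so that the
grid carries excess risk `C₃ h^κ'`, the most that the strip condition allows; `κ' > κ - 1` makes
this possible with `w ≤ 1`.

A strategy spreads `n` queries over disjoint columns. If `n h^(2(κ-1))` is at most a small multiple
of `K^(d-1)`, a fixed fraction of the signs stays undetermined for some `σ`
(`exists_le_expectedExcessRisk`), at a cost of order `h^κ'`. Taking `K` of order
`n^(1/(2α(κ-1)+d-1))` gives the rate. -/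

namespace ActiveLearning
noncomputable section

/-! ### Taylor remainders and Hölder classes -/

lemma iteratedDeriv_comp_line {E : Type*} [NormedAddCommGroup E] [NormedSpace ℝ E]
    {g : E → ℝ} {n : WithTop ℕ∞} (hg : ContDiff ℝ n g) (y v : E) (j : ℕ) (hj : (j : WithTop ℕ∞) ≤ n) (t : ℝ) :
    iteratedDeriv j (fun t : ℝ => g (y + t • v)) t
      = iteratedFDeriv ℝ j g (y + t • v) (fun _ => v) := by
  have h1 : (fun t : ℝ => g (y + t • v))
      = (fun z => g (y + z)) ∘ (ContinuousLinearMap.toSpanSingleton ℝ v) := by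
    ext t; simp
  rw [iteratedDeriv, h1, ContinuousLinearMap.iteratedFDeriv_comp_right _ _ _ hj]
  · rw [iteratedFDeriv_comp_add_left]
    simp [ContinuousMultilinearMap.compContinuousLinearMap_apply]
  · exact hg.comp (contDiff_const.add contDiff_id)

/-- Apply the one-variable remainder bound to `g` along the segment from `y` to `x`; the factor `1 /
k!` is discarded. -/
lemma abs_sub_taylor_le {E : Type*} [NormedAddCommGroup E] [NormedSpace ℝ E]
    {g : E → ℝ} {k : ℕ} (hg : ContDiff ℝ (k + 1 : ℕ) g) {M : ℝ}
    (hM : ∀ z, ‖iteratedFDeriv ℝ (k + 1) g z‖ ≤ M) (x y : E) :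
    |g x - ∑ j ∈ Finset.range (k + 1),
      ((j.factorial : ℝ))⁻¹ * iteratedFDeriv ℝ j g y (fun _ => x - y)| ≤ M * ‖x - y‖ ^ (k + 1) := by
  set p : ℝ → ℝ := fun t => g (y + t • (x - y)) with hp
  have hpc : ContDiff ℝ (k + 1 : ℕ) p :=
    hg.comp (contDiff_const.add (contDiff_id.smul contDiff_const))
  have hder : ∀ j ≤ k + 1, ∀ t ∈ Icc (0 : ℝ) 1, iteratedDerivWithin j p (Icc 0 1) t
      = iteratedFDeriv ℝ j g (y + t • (x - y)) (fun _ => x - y) := by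
    intro j hj t ht
    have hj' : (j : WithTop ℕ∞) ≤ ((k + 1 : ℕ) : WithTop ℕ∞) := by exact_mod_cast hj
    rw [iteratedDerivWithin_eq_iteratedDeriv (uniqueDiffOn_Icc one_pos)
      ((hpc.of_le hj').contDiffAt) ht, iteratedDeriv_comp_line hg _ _ _ hj']
  have hMnn : 0 ≤ M := (norm_nonneg _).trans (hM y)
  have hb := taylor_mean_remainder_bound (f := p) (n := k) (C := M * ‖x - y‖ ^ (k + 1)) zero_le_one
    (by exact_mod_cast hpc.contDiffOn) (right_mem_Icc.2 zero_le_one) (fun t ht => by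
      rw [hder _ le_rfl t ht]
      refine (ContinuousMultilinearMap.le_opNorm _ _).trans ?_
      simp only [Finset.prod_const, Finset.card_univ, Fintype.card_fin]
      gcongr
      exact hM _)
  rw [taylor_within_apply] at hb
  have hs : ∑ j ∈ Finset.range (k + 1), ((j.factorial : ℝ)⁻¹ * ((1 : ℝ) - 0) ^ j) •
      iteratedDerivWithin j p (Icc 0 1) 0 = ∑ j ∈ Finset.range (k + 1),
      ((j.factorial : ℝ))⁻¹ * iteratedFDeriv ℝ j g y (fun _ => x - y) := by
    refine Finset.sum_congr rfl fun j hj => ?_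
    rw [hder j (by have := Finset.mem_range.1 hj; omega) 0 (left_mem_Icc.2 zero_le_one)]
    simp
  rw [hs] at hb
  simp only [hp, one_smul, add_sub_cancel, Real.norm_eq_abs, sub_zero, one_pow, mul_one] at hb
  refine hb.trans (div_le_self (by positivity) ?_)
  exact_mod_cast Nat.succ_le_of_lt (Nat.factorial_pos k)

/-- A smooth function whose derivatives have the size of those of `h G(K ·)`, with `G` having
derivatives bounded by `B`, has Taylor remainders controlled at every Hölder exponent. -/
lemma abs_sub_taylor_le_rpow {E : Type*} [NormedAddCommGroup E] [NormedSpace ℝ E]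
    {g : E → ℝ} {k : ℕ} (hg : ContDiff ℝ (k + 1 : ℕ) g) {b h K B β : ℝ}
    (hh : 0 ≤ h) (hK : 0 ≤ K) (hB : 0 ≤ B) (h0 : ∀ z, |g z - b| ≤ h * B)
    (hM : ∀ j ∈ Finset.Icc 1 (k + 1), ∀ z, ‖iteratedFDeriv ℝ j g z‖ ≤ h * K ^ j * B)
    (hβ₁ : (k : ℝ) ≤ β) (hβ₂ : β ≤ k + 1) (x y : E) :
    |g x - ∑ j ∈ Finset.range (k + 1),
      ((j.factorial : ℝ))⁻¹ * iteratedFDeriv ℝ j g y (fun _ => x - y)|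
      ≤ h * B * (k + 2) * (K * ‖x - y‖) ^ β := by
  set r := K * ‖x - y‖ with hr
  have hr0 : 0 ≤ r := by positivity
  -- Below the scale `1 / K` of the bumps the remainder of order `k + 1` is small. Above it the
  -- remainder gains nothing, and each Taylor term is bounded separately: `k` derivative terms, plus
  -- two for `g x - b` and `g y - b`, hence the factor `k + 2`.
  rcases le_total r 1 with hr1 | hr1
  · rcases hr0.eq_or_lt with hr00 | hr00
    · have h1 := abs_sub_taylor_le hg (hM (k + 1) (by simp)) x y
      have e : h * K ^ (k + 1) * B * ‖x - y‖ ^ (k + 1) = h * B * r ^ (k + 1) := by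
        rw [hr, mul_pow]; ring
      rw [e, ← hr00, zero_pow (by omega), mul_zero] at h1
      exact h1.trans (by positivity)
    have h1 := abs_sub_taylor_le hg (hM (k + 1) (by simp)) x y
    refine h1.trans ?_
    have e : h * K ^ (k + 1) * B * ‖x - y‖ ^ (k + 1) = h * B * r ^ (k + 1) := by
      rw [hr, mul_pow]; ring
    have e2 : r ^ (k + 1) ≤ r ^ β := by
      rw [← Real.rpow_natCast]
      exact Real.rpow_le_rpow_of_exponent_ge hr00 hr1 (by push_cast; exact hβ₂)
    rw [e]
    have : 0 ≤ r ^ β := by positivity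
    calc h * B * r ^ (k + 1) ≤ h * B * r ^ β := by gcongr
      _ ≤ h * B * (k + 2) * r ^ β := by
        have h3 : 0 ≤ h * B * r ^ β := by positivity
        have h4 : (0 : ℝ) ≤ k := by positivity
        nlinarith [mul_nonneg h3 h4]
  · have e2 : r ^ k ≤ r ^ β := by
      rw [← Real.rpow_natCast]
      exact Real.rpow_le_rpow_of_exponent_le hr1 hβ₁
    have e1 : ∀ j ≤ k, r ^ j ≤ r ^ β := fun j hj => (pow_le_pow_right₀ hr1 hj).trans e2
    rw [Finset.sum_range_succ']
    simp only [Nat.factorial_zero, Nat.cast_one, inv_one, one_mul, iteratedFDeriv_zero_apply]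
    have hsum : |∑ j ∈ Finset.range k, (((j + 1).factorial : ℝ))⁻¹ *
        iteratedFDeriv ℝ (j + 1) g y (fun _ => x - y)| ≤ k * (h * B * r ^ β) := by
      refine (Finset.abs_sum_le_sum_abs _ _).trans ?_
      refine (Finset.sum_le_card_nsmul _ _ (h * B * r ^ β) fun j hj => ?_).trans (by simp)
      have hj' := Finset.mem_range.1 hj
      rw [abs_mul]
      have i1 : |(((j + 1).factorial : ℝ))⁻¹| ≤ 1 := by
        rw [abs_of_nonneg (by positivity)]
        exact inv_le_one_of_one_le₀ (by exact_mod_cast Nat.succ_le_of_lt (Nat.factorial_pos _))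
      have i2 : |iteratedFDeriv ℝ (j + 1) g y (fun _ => x - y)| ≤ h * B * r ^ β := by
        rw [← Real.norm_eq_abs]
        refine (ContinuousMultilinearMap.le_opNorm _ _).trans ?_
        simp only [Finset.prod_const, Finset.card_univ, Fintype.card_fin]
        calc _ ≤ h * K ^ (j + 1) * B * ‖x - y‖ ^ (j + 1) := by
              gcongr; exact hM _ (by simp; omega) _
          _ = h * B * r ^ (j + 1) := by rw [hr, mul_pow]; ring
          _ ≤ _ := mul_le_mul_of_nonneg_left (e1 _ (by omega)) (by positivity)
      calc _ ≤ 1 * (h * B * r ^ β) := by gcongr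
        _ = _ := one_mul _
    have h1 : 1 ≤ r ^ β := by simpa using e1 0 (Nat.zero_le _)
    have hx := h0 x
    have hy := h0 y
    have h2 : h * B * 1 ≤ h * B * r ^ β := by gcongr
    rw [abs_le] at *
    constructor <;> nlinarith

/-! ### Sums of disjoint bumps -/

/-- A fixed smooth bump on `ℝ^m`, supported in the cube of half-width `1/4`. -/
def bump (m : ℕ) : ContDiffBump (0 : Fin m → ℝ) := ⟨1 / 8, 1 / 4, by norm_num, by norm_num⟩

/-- The centre of the unit cell with index `j`. -/
def cellCenter {m K : ℕ} (j : Fin m → Fin K) : Fin m → ℝ := fun i => (j i : ℝ) + 1 / 2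

lemma cellCenter_inj {m K : ℕ} {i j : Fin m → Fin K} {u : Fin m → ℝ}
    (hi : ‖u - cellCenter i‖ ≤ 1 / 4) (hj : ‖u - cellCenter j‖ ≤ 1 / 4) : i = j := by
  ext l
  have h1 := abs_le.1 ((norm_le_pi_norm (u - cellCenter i) l).trans hi)
  have h2 := abs_le.1 ((norm_le_pi_norm (u - cellCenter j) l).trans hj)
  simp only [Pi.sub_apply, cellCenter] at h1 h2
  have h3 : ((i l : ℕ) : ℝ) < (j l : ℕ) + 1 := by linarith [h1.1, h1.2, h2.1, h2.2]
  have h4 : ((j l : ℕ) : ℝ) < (i l : ℕ) + 1 := by linarith [h1.1, h1.2, h2.1, h2.2]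
  norm_cast at h3 h4
  omega

/-- The sign `±1` of a bit. -/
def bitSign (s : Bool) : ℝ := if s then 1 else -1

lemma abs_bitSign (s : Bool) : |bitSign s| = 1 := by cases s <;> simp [bitSign]

/-- The sum of the bumps over all cells, with signs `σ`. -/
def bumpSum {m K : ℕ} (σ : (Fin m → Fin K) → Bool) (u : Fin m → ℝ) : ℝ :=
  ∑ j, bitSign (σ j) • bump m (u - cellCenter j)

lemma contDiff_bumpSum {m K : ℕ} (σ : (Fin m → Fin K) → Bool) {n : ℕ∞} :
    ContDiff ℝ n (bumpSum σ) :=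
  ContDiff.sum fun j _ =>
    ((bump m).contDiff.comp (contDiff_id.sub contDiff_const)).const_smul (bitSign (σ j))

lemma norm_sum_le_of_unique {ι F : Type*} [Fintype ι] [NormedAddCommGroup F]
    {f : ι → F} {B : ℝ} (hB : 0 ≤ B) (hf : ∀ i, ‖f i‖ ≤ B)
    (huniq : ∀ i j, f i ≠ 0 → f j ≠ 0 → i = j) : ‖∑ i, f i‖ ≤ B := by
  classical
  by_cases h : ∃ i, f i ≠ 0
  · obtain ⟨i, hi⟩ := h
    rw [Finset.sum_eq_single i (fun j _ hj => by
      by_contra h; exact hj (huniq _ _ h hi)) (by simp)]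
    exact hf i
  · push Not at h
    simpa [h] using hB

/-- The bound of a single bump serves for all `K` and `σ`, because at most one summand has a nonzero
derivative at any point. -/
lemma exists_bound_iteratedFDeriv_bumpSum (m i : ℕ) : ∃ B : ℝ, 0 ≤ B ∧
    ∀ (K : ℕ) (σ : (Fin m → Fin K) → Bool) (u : Fin m → ℝ),
      ‖iteratedFDeriv ℝ i (bumpSum σ) u‖ ≤ B := by
  obtain ⟨B, hB⟩ := ((bump m).hasCompactSupport.iteratedFDeriv (𝕜 := ℝ) i).exists_bound_of_continuous
    (((bump m).contDiff (n := i)).continuous_iteratedFDeriv le_rfl)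
  have hB0 : 0 ≤ B := (norm_nonneg _).trans (hB 0)
  refine ⟨B, hB0, fun K σ u => ?_⟩
  have hcd : ∀ j : Fin m → Fin K, ContDiff ℝ i (fun u => bump m (u - cellCenter j)) := fun j =>
    (bump m).contDiff.comp (contDiff_id.sub contDiff_const)
  have e : iteratedFDeriv ℝ i (bumpSum σ) u
      = ∑ j, bitSign (σ j) • iteratedFDeriv ℝ i (bump m) (u - cellCenter j) := by
    unfold bumpSum
    rw [iteratedFDeriv_fun_sum_apply fun j _ => ((hcd j).const_smul (bitSign (σ j))).contDiffAt]
    refine Finset.sum_congr rfl fun j _ => ?_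
    rw [iteratedFDeriv_const_smul_apply' (hcd j).contDiffAt, iteratedFDeriv_comp_sub]
  rw [e]
  refine norm_sum_le_of_unique hB0 (fun j => ?_) fun j l hj hl => ?_
  · rw [norm_smul, Real.norm_eq_abs, abs_bitSign, one_mul]
    exact hB _
  · have key : ∀ j : Fin m → Fin K,
        bitSign (σ j) • iteratedFDeriv ℝ i (bump m) (u - cellCenter j) ≠ 0 →
        ‖u - cellCenter j‖ ≤ 1 / 4 := by
      intro j hj
      have h1 := support_iteratedFDeriv_subset (𝕜 := ℝ) (f := bump m) i
        (Function.mem_support.2 (right_ne_zero_of_smul hj))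
      rw [(bump m).tsupport_eq] at h1
      simpa [bump] using h1
    exact cellCenter_inj (key j hj) (key l hl)

lemma bump_eq_zero {m : ℕ} {u : Fin m → ℝ} (hu : 1 / 4 ≤ ‖u‖) : bump m u = 0 :=
  (bump m).zero_of_le_dist (by simpa [bump] using hu)

lemma norm_le_of_bump_ne_zero {m : ℕ} {u : Fin m → ℝ} (hu : bump m u ≠ 0) : ‖u‖ ≤ 1 / 4 := by
  by_contra h
  exact hu (bump_eq_zero (not_le.1 h).le)

lemma abs_bumpSum_le_one {m K : ℕ} (σ : (Fin m → Fin K) → Bool) (u : Fin m → ℝ) :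
    |bumpSum σ u| ≤ 1 := by
  refine norm_sum_le_of_unique zero_le_one (fun j => ?_) fun i j hi hj =>
    cellCenter_inj (norm_le_of_bump_ne_zero (right_ne_zero_of_smul hi))
      (norm_le_of_bump_ne_zero (right_ne_zero_of_smul hj))
  rw [norm_smul, Real.norm_eq_abs, abs_bitSign, one_mul, Real.norm_eq_abs,
    abs_of_nonneg (bump m).nonneg]
  exact (bump m).le_one

lemma bumpSum_cellCenter {m K : ℕ} (σ : (Fin m → Fin K) → Bool) (j : Fin m → Fin K) :
    bumpSum σ (cellCenter j) = bitSign (σ j) := by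
  unfold bumpSum
  rw [Finset.sum_eq_single j (fun i _ hi => ?_) (by simp)]
  · have : bump m (cellCenter j - cellCenter j) = 1 :=
      (bump m).one_of_mem_closedBall (by simp [bump])
    rw [this, smul_eq_mul, mul_one]
  · by_contra h
    exact hi (cellCenter_inj (norm_le_of_bump_ne_zero (right_ne_zero_of_smul h)) (by simp))

lemma bumpSum_update {m K : ℕ} (σ : (Fin m → Fin K) → Bool) (j : Fin m → Fin K) (s : Bool)
    {u : Fin m → ℝ} (hu : 1 / 4 ≤ ‖u - cellCenter j‖) :
    bumpSum (Function.update σ j s) u = bumpSum σ u := by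
  refine Finset.sum_congr rfl fun i _ => ?_
  by_cases h : i = j
  · subst h; simp [bump_eq_zero hu]
  · rw [Function.update_of_ne h]

/-! ### Perturbed boundaries -/

/-- The level `b`, perturbed by bumps of height `h` over a grid of `K^m` cells. -/
def bumpBoundary {m K : ℕ} (b h : ℝ) (σ : (Fin m → Fin K) → Bool) (x : Fin m → ℝ) : ℝ :=
  b + h * bumpSum σ ((K : ℝ) • x)

lemma contDiff_bumpBoundary {m K : ℕ} (b h : ℝ) (σ : (Fin m → Fin K) → Bool) {n : ℕ∞} :
    ContDiff ℝ n (bumpBoundary b h σ) :=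
  contDiff_const.add (contDiff_const.mul ((contDiff_bumpSum σ).comp (contDiff_id.const_smul (K : ℝ))))

lemma abs_bumpBoundary_sub_le {m K : ℕ} {b h : ℝ} (hh : 0 ≤ h) (σ : (Fin m → Fin K) → Bool)
    (x : Fin m → ℝ) : |bumpBoundary b h σ x - b| ≤ h := by
  rw [bumpBoundary, add_sub_cancel_left, abs_mul, abs_of_nonneg hh]
  exact mul_le_of_le_one_right hh (abs_bumpSum_le_one _ _)

lemma iteratedFDeriv_bumpBoundary {m K : ℕ} (b h : ℝ) (σ : (Fin m → Fin K) → Bool)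
    {j : ℕ} (hj : 1 ≤ j) (x : Fin m → ℝ) :
    iteratedFDeriv ℝ j (bumpBoundary b h σ) x
      = h • (K : ℝ) ^ j • iteratedFDeriv ℝ j (bumpSum σ) ((K : ℝ) • x) := by
  have hcd : ContDiff ℝ j (fun x => bumpSum σ ((K : ℝ) • x)) :=
    (contDiff_bumpSum σ (n := j)).comp (contDiff_id.const_smul (K : ℝ))
  have e : bumpBoundary b h σ = (fun _ => b) + (fun x => h • bumpSum σ ((K : ℝ) • x)) := by
    ext x; simp [bumpBoundary]
  rw [e, iteratedFDeriv_add_apply contDiff_const.contDiffAt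
    (hcd.const_smul h).contDiffAt, iteratedFDeriv_const_of_ne (by omega),
    iteratedFDeriv_const_smul_apply' hcd.contDiffAt,
    iteratedFDeriv_comp_const_smul _ (contDiff_bumpSum σ (n := j))]
  simp

/-- The remainder at exponent `β` is at most a constant times `h (K ‖x - y‖)^β`, and `K^β ≤ K^α`.
One condition on `h K^α` therefore handles every `β ≤ α`. -/
lemma isHolder_bumpBoundary (m : ℕ) {lam α : ℝ} (hlam : 1 ≤ lam) :
    ∃ A : ℝ, 0 < A ∧ ∀ (K : ℕ) (b h : ℝ) (σ : (Fin m → Fin K) → Bool), 1 ≤ K → 0 ≤ h →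
      h ≤ b → b + h ≤ 1 → A * h * (K : ℝ) ^ α ≤ 1 → IsHolder lam α (bumpBoundary b h σ) := by
  choose B hB0 hB using exists_bound_iteratedFDeriv_bumpSum m
  set k₀ := strictFloor α
  -- The summand `1` gives `h ≤ h * B'`, which covers the order-zero bound.
  set B' : ℝ := 1 + ∑ i ∈ Finset.range (k₀ + 2), B i with hB'
  have hBle : ∀ i ≤ k₀ + 1, B i ≤ B' := fun i hi => by
    have := Finset.single_le_sum (f := B) (fun i _ => hB0 i)
      (Finset.mem_range.2 (by omega : i < k₀ + 2))
    linarith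
  have hB'1 : 1 ≤ B' := by
    have := Finset.sum_nonneg (s := Finset.range (k₀ + 2)) (fun i _ => hB0 i)
    linarith
  have hB'0 : 0 ≤ B' := by linarith
  refine ⟨B' * (k₀ + 2), by positivity, fun K b h σ hK hh hhb hbh hA => ?_⟩
  have hK1 : (1 : ℝ) ≤ K := by exact_mod_cast hK
  have habs := fun x => abs_le.1 (abs_bumpBoundary_sub_le (b := b) hh σ x)
  refine ⟨fun x _ => ⟨by linarith [(habs x).1], by linarith [(habs x).2]⟩,
    (contDiff_bumpBoundary b h σ (n := (strictFloor α : ℕ))).contDiffOn,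
    fun x hx y hy β hβ hβα => ?_⟩
  -- Here `k < β ≤ k + 1`, also when `β` is an integer.
  set k := strictFloor β with hk
  have hceil : 1 ≤ ⌈β⌉₊ := Nat.one_le_ceil_iff.2 hβ
  have hkk : k ≤ k₀ := Nat.sub_le_sub_right (Nat.ceil_mono hβα) 1
  have hβ2 : β ≤ k + 1 := by
    have h1 := Nat.le_ceil β
    have h2 : ((⌈β⌉₊ : ℕ) : ℝ) = k + 1 := by
      have : ⌈β⌉₊ = k + 1 := by simp only [hk, strictFloor]; omega
      exact_mod_cast this
    linarith
  have hβ1 : (k : ℝ) ≤ β := (Nat.lt_ceil.1 (by simp only [hk, strictFloor]; omega)).le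
  have hud : UniqueDiffOn ℝ (Icc (0 : Fin m → ℝ) 1) := by
    refine uniqueDiffOn_convex (convex_Icc _ _) ?_
    rw [← Set.pi_univ_Icc, interior_pi_set Set.finite_univ]
    refine ⟨fun _ => 1 / 2, fun i _ => ?_⟩
    simp; norm_num
  have e : taylorPoly (bumpBoundary b h σ) k y x = ∑ j ∈ Finset.range (k + 1),
      ((j.factorial : ℝ))⁻¹ * iteratedFDeriv ℝ j (bumpBoundary b h σ) y (fun _ => x - y) := by
    refine Finset.sum_congr rfl fun j _ => ?_
    rw [iteratedFDerivWithin_eq_iteratedFDeriv hud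
      (contDiff_bumpBoundary b h σ (n := j)).contDiffAt hy]
  rw [e]
  refine (abs_sub_taylor_le_rpow (contDiff_bumpBoundary b h σ (n := (k + 1 : ℕ))) (b := b) hh
    (zero_le_one.trans hK1) hB'0 (fun z => ?_) (fun j hj z => ?_) hβ1 hβ2 x y).trans ?_
  · exact (abs_bumpBoundary_sub_le hh σ z).trans (le_mul_of_one_le_right hh hB'1)
  · have hj' := Finset.mem_Icc.1 hj
    rw [iteratedFDeriv_bumpBoundary b h σ hj'.1, norm_smul, norm_smul, Real.norm_of_nonneg hh,
      Real.norm_of_nonneg (by positivity), mul_assoc]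
    gcongr
    exact (hB j K σ _).trans (hBle j (by omega))
  · rw [Real.mul_rpow (by positivity) (norm_nonneg _), ← mul_assoc]
    refine mul_le_mul_of_nonneg_right ?_ (by positivity)
    refine le_trans ?_ hlam
    refine le_trans ?_ hA
    have h1 : (K : ℝ) ^ β ≤ (K : ℝ) ^ α := Real.rpow_le_rpow_of_exponent_le hK1 hβα
    have h2 : (k : ℝ) ≤ k₀ := by exact_mod_cast hkk
    calc h * B' * (k + 2) * (K : ℝ) ^ β ≤ h * B' * (k₀ + 2) * (K : ℝ) ^ α := by gcongr
      _ = _ := by ring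

/-! ### Laws of histories -/

section Histories

variable {d n : ℕ}

lemma measurable_snoc (A : ActiveStrategy.{u} d n) (t : ℕ) :
    Measurable (fun p : (A.Seed × History d t) × Bool =>
      ((p.1.1, Fin.snoc p.1.2 (A.query t p.1, p.2)) : A.Seed × History d (t + 1))) := by
  refine measurable_fst.fst.prodMk (measurable_pi_lambda _ fun i => ?_)
  refine Fin.lastCases ?_ (fun i => ?_) i
  · simp only [Fin.snoc_last]
    exact ((A.measurable_query t).comp measurable_fst).prodMk measurable_snd
  · simp only [Fin.snoc_castSucc]
    exact (measurable_pi_apply i).comp measurable_fst.snd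

lemma isProbabilityMeasure_law (A : ActiveStrategy.{u} d n) (P : Problem d) (t : ℕ) :
    IsProbabilityMeasure (A.law P t) := by
  have := A.isProb
  induction t with
  | zero =>
    exact Measure.isProbabilityMeasure_map (measurable_id.prodMk measurable_const).aemeasurable
  | succ t ih => exact Measure.isProbabilityMeasure_map (measurable_snoc A t).aemeasurable

/-- The probability of the label `z.2` at the point `z.1`. -/
def Problem.labelProb (P : Problem d) (z : Feature d × Bool) : ℝ :=
  if z.2 then P.η z.1 else 1 - P.η z.1

lemma Problem.labelProb_nonneg (P : Problem d) (z : Feature d × Bool) : 0 ≤ P.labelProb z := by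
  have h := P.η_mem z.1
  unfold Problem.labelProb
  split_ifs
  · exact h.1
  · linarith [h.2]

lemma Problem.measurable_labelProb (P : Problem d) : Measurable P.labelProb :=
  Measurable.ite (measurable_snd (measurableSet_singleton true))
    (P.measurable_η.comp measurable_fst) (measurable_const.sub (P.measurable_η.comp measurable_fst))

lemma Problem.lintegral_labelKernel (P : Problem d) (x : Feature d) (Φ : Bool → ℝ≥0∞) :
    ∫⁻ y, Φ y ∂(P.labelKernel x)
      = ENNReal.ofReal (P.labelProb (x, true)) * Φ true
        + ENNReal.ofReal (P.labelProb (x, false)) * Φ false := by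
  change ∫⁻ y, Φ y ∂(ENNReal.ofReal (P.η x) • Measure.dirac true
    + ENNReal.ofReal (1 - P.η x) • Measure.dirac false : Measure Bool) = _
  rw [lintegral_add_measure, lintegral_smul_measure, lintegral_smul_measure, lintegral_dirac,
    lintegral_dirac]
  simp [Problem.labelProb]

lemma lintegral_law_succ (A : ActiveStrategy.{u} d n) (P : Problem d) (t : ℕ)
    {Φ : A.Seed × History d (t + 1) → ℝ≥0∞} (hΦ : Measurable Φ) :
    ∫⁻ p, Φ p ∂(A.law P (t + 1)) = ∫⁻ p,
      (ENNReal.ofReal (P.labelProb (A.query t p, true))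
          * Φ (p.1, Fin.snoc p.2 (A.query t p, true))
        + ENNReal.ofReal (P.labelProb (A.query t p, false))
          * Φ (p.1, Fin.snoc p.2 (A.query t p, false))) ∂(A.law P t) := by
  have := isProbabilityMeasure_law A P t
  rw [ActiveStrategy.law, lintegral_map hΦ (measurable_snoc A t),
    Measure.lintegral_compProd (by exact hΦ.comp (measurable_snoc A t))]
  refine lintegral_congr fun p => ?_
  rw [Kernel.comap_apply, P.lintegral_labelKernel]

lemma measurable_snoc_const (A : ActiveStrategy.{u} d n) (t : ℕ) (y : Bool) :
    Measurable (fun p : A.Seed × History d t =>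
      ((p.1, Fin.snoc p.2 (A.query t p, y)) : A.Seed × History d (t + 1))) :=
  (measurable_snoc A t).comp (measurable_id.prodMk measurable_const)

/-! ### Likelihood ratios with respect to fair labels -/

/-- A problem with labels that are fair coins. -/
def fairProblem (d : ℕ) : Problem d where
  PX := Measure.dirac (fun _ => 0, 0)
  isProb := inferInstance
  η := fun _ => 1 / 2
  measurable_η := measurable_const
  η_mem := fun _ => by norm_num

lemma fairProblem_labelProb (z : Feature d × Bool) : (fairProblem d).labelProb z = 1 / 2 := by
  unfold Problem.labelProb fairProblem
  split_ifs <;> norm_num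

/-- The likelihood of a history, relative to fair labels. -/
def Problem.likelihood (P : Problem d) {t : ℕ} (h : History d t) : ℝ :=
  ∏ s, (2 * P.labelProb (h s))

lemma Problem.likelihood_nonneg (P : Problem d) {t : ℕ} (h : History d t) :
    0 ≤ P.likelihood h :=
  Finset.prod_nonneg fun _ _ => mul_nonneg zero_le_two (P.labelProb_nonneg _)

lemma Problem.measurable_likelihood (P : Problem d) (t : ℕ) :
    Measurable (P.likelihood : History d t → ℝ) :=
  Finset.measurable_prod _ fun s _ =>
    (P.measurable_labelProb.comp (measurable_pi_apply s)).const_mul 2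

lemma measurable_likelihood_snd (A : ActiveStrategy.{u} d n) (P : Problem d) (t : ℕ) :
    Measurable fun p : A.Seed × History d t => ENNReal.ofReal (P.likelihood p.2) :=
  ((P.measurable_likelihood t).comp measurable_snd).ennreal_ofReal

lemma Problem.likelihood_snoc (P : Problem d) {t : ℕ} (h : History d t) (z : Feature d × Bool) :
    P.likelihood (Fin.snoc h z : History d (t + 1)) = P.likelihood h * (2 * P.labelProb z) := by
  simp only [Problem.likelihood, Fin.prod_univ_castSucc, Fin.snoc_castSucc, Fin.snoc_last]

/-- Queries are the same functions of the past under every problem, so the laws differ only through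
the label probabilities. All comparisons can then be made under the single fair-coin law, whose
marginal plays no role. -/
lemma lintegral_law_eq (A : ActiveStrategy.{u} d n) (P : Problem d) (t : ℕ)
    {Φ : A.Seed × History d t → ℝ≥0∞} (hΦ : Measurable Φ) :
    ∫⁻ p, Φ p ∂(A.law P t)
      = ∫⁻ p, ENNReal.ofReal (P.likelihood p.2) * Φ p ∂(A.law (fairProblem d) t) := by
  induction t with
  | zero => simp [Problem.likelihood, ActiveStrategy.law]
  | succ t ih =>
    have hL := measurable_likelihood_snd A P
    have hq : ∀ y, Measurable fun p => ENNReal.ofReal (P.labelProb (A.query t p, y)) := fun y =>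
      (P.measurable_labelProb.comp ((A.measurable_query t).prodMk measurable_const)).ennreal_ofReal
    rw [lintegral_law_succ A P t hΦ, lintegral_law_succ A _ t ((hL (t + 1)).fun_mul hΦ), ih]
    · refine lintegral_congr fun p => ?_
      have e : ∀ z : Feature d × Bool, ENNReal.ofReal ((fairProblem d).labelProb z) *
          ENNReal.ofReal (P.likelihood (Fin.snoc p.2 z : History d (t + 1)))
          = ENNReal.ofReal (P.likelihood p.2) * ENNReal.ofReal (P.labelProb z) := by
        intro z
        rw [fairProblem_labelProb, P.likelihood_snoc, ← ENNReal.ofReal_mul (by norm_num),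
          ← ENNReal.ofReal_mul (P.likelihood_nonneg _)]
        congr 1; ring
      dsimp only
      rw [← mul_assoc, ← mul_assoc, e, e]
      ring
    · exact ((hq true).mul (hΦ.comp (measurable_snoc_const A t true))).add
        ((hq false).mul (hΦ.comp (measurable_snoc_const A t false)))

/-! ### Number of queries in a set -/

/-- The number of points of a history that lie in `S`. -/
def countIn (S : Set (Feature d)) {t : ℕ} (h : History d t) : ℝ≥0∞ :=
  ∑ s, S.indicator 1 (h s).1

lemma measurable_countIn {S : Set (Feature d)} (hS : MeasurableSet S) (t : ℕ) :
    Measurable (countIn S : History d t → ℝ≥0∞) :=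
  Finset.measurable_sum _ fun s _ =>
    (measurable_one.indicator hS).comp (measurable_pi_apply s).fst

lemma measurable_countIn_snd (A : ActiveStrategy.{u} d n) {S : Set (Feature d)}
    (hS : MeasurableSet S) (t : ℕ) :
    Measurable fun p : A.Seed × History d t => countIn S p.2 :=
  (measurable_countIn hS t).comp measurable_snd

lemma countIn_snoc (S : Set (Feature d)) {t : ℕ} (h : History d t) (z : Feature d × Bool) :
    countIn S (Fin.snoc h z : History d (t + 1)) = countIn S h + S.indicator 1 z.1 := by
  simp only [countIn, Fin.sum_univ_castSucc, Fin.snoc_castSucc, Fin.snoc_last]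

/-- The expected number of queries in `S` among the first `t`. -/
def ActiveStrategy.expectedCount (A : ActiveStrategy.{u} d n) (P : Problem d)
    (S : Set (Feature d)) (t : ℕ) : ℝ≥0∞ :=
  ∫⁻ p, countIn S p.2 ∂(A.law P t)

lemma Problem.ofReal_labelProb_add (P : Problem d) (x : Feature d) :
    ENNReal.ofReal (P.labelProb (x, true)) + ENNReal.ofReal (P.labelProb (x, false)) = 1 := by
  rw [← ENNReal.ofReal_add (P.labelProb_nonneg _) (P.labelProb_nonneg _)]
  simp [Problem.labelProb]

lemma measurable_indicator_query (A : ActiveStrategy.{u} d n) {S : Set (Feature d)}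
    (hS : MeasurableSet S) (t : ℕ) :
    Measurable fun p => S.indicator (1 : Feature d → ℝ≥0∞) (A.query t p) :=
  (measurable_one.indicator hS).comp (A.measurable_query t)

/-- The increment is expressed under the fair-coin law to match the loss of affinity in
`one_le_affinity_add`. -/
lemma expectedCount_succ (A : ActiveStrategy.{u} d n) (P : Problem d) {S : Set (Feature d)}
    (hS : MeasurableSet S) (t : ℕ) :
    A.expectedCount P S (t + 1) = A.expectedCount P S t
      + ∫⁻ p, ENNReal.ofReal (P.likelihood p.2) * S.indicator 1 (A.query t p)
          ∂(A.law (fairProblem d) t) := by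
  unfold ActiveStrategy.expectedCount
  rw [← lintegral_law_eq A P t (measurable_indicator_query A hS t),
    lintegral_law_succ A P t (measurable_countIn_snd A hS (t + 1)),
    ← lintegral_add_left (measurable_countIn_snd A hS t)]
  refine lintegral_congr fun p => ?_
  simp only [countIn_snoc]
  rw [← add_mul, P.ofReal_labelProb_add, one_mul]

lemma sum_expectedCount_le {ι : Type*} [Fintype ι] (A : ActiveStrategy.{u} d n) (P : Problem d)
    {S : ι → Set (Feature d)} (hS : ∀ j, MeasurableSet (S j))
    (hdisj : Pairwise (Function.onFun Disjoint S)) (t : ℕ) :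
    ∑ j, A.expectedCount P (S j) t ≤ t := by
  have := isProbabilityMeasure_law A P t
  unfold ActiveStrategy.expectedCount
  rw [← lintegral_finsetSum _ fun j _ => measurable_countIn_snd A (hS j) t]
  refine (lintegral_mono (g := fun _ => (t : ℝ≥0∞)) fun p => ?_).trans (by simp)
  simp only [countIn]
  rw [Finset.sum_comm]
  refine (Finset.sum_le_card_nsmul _ _ 1 fun s _ => ?_).trans (by simp)
  by_cases h : ∃ j, (p.2 s).1 ∈ S j
  · obtain ⟨j, hj⟩ := h
    rw [Finset.sum_eq_single j (fun i _ hi => ?_) (by simp)]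
    · simp [hj]
    · exact indicator_of_notMem (fun hi' => (hdisj hi).le_bot ⟨hi', hj⟩) _
  · push Not at h
    simp [h]

/-! ### Two-point bound -/

/-- The Hellinger affinity of the label laws of two problems at a point. -/
def affinity (P Q : Problem d) (x : Feature d) : ℝ :=
  √(P.labelProb (x, true) * Q.labelProb (x, true))
    + √(P.labelProb (x, false) * Q.labelProb (x, false))

/-- The Hellinger affinity of the laws of a strategy run on two problems. -/
def ActiveStrategy.affinity (A : ActiveStrategy.{u} d n) (P Q : Problem d) (t : ℕ) : ℝ≥0∞ :=
  ∫⁻ p, ENNReal.ofReal √(P.likelihood p.2 * Q.likelihood p.2) ∂(A.law (fairProblem d) t)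

lemma measurable_sqrt_likelihood_mul (A : ActiveStrategy.{u} d n) (P Q : Problem d) (t : ℕ) :
    Measurable fun p : A.Seed × History d t =>
      ENNReal.ofReal √(P.likelihood p.2 * Q.likelihood p.2) :=
  (((P.measurable_likelihood t).comp measurable_snd).mul
    ((Q.measurable_likelihood t).comp measurable_snd)).sqrt.ennreal_ofReal

lemma affinity_succ (A : ActiveStrategy.{u} d n) (P Q : Problem d) (t : ℕ) :
    A.affinity P Q (t + 1) = ∫⁻ p, ENNReal.ofReal
      (√(P.likelihood p.2 * Q.likelihood p.2) * affinity P Q (A.query t p))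
      ∂(A.law (fairProblem d) t) := by
  rw [ActiveStrategy.affinity,
    lintegral_law_succ A _ t (measurable_sqrt_likelihood_mul A P Q (t + 1))]
  refine lintegral_congr fun p => ?_
  have e : ∀ z : Feature d × Bool, ENNReal.ofReal ((fairProblem d).labelProb z) *
      ENNReal.ofReal √(P.likelihood (Fin.snoc p.2 z : History d (t + 1))
        * Q.likelihood (Fin.snoc p.2 z : History d (t + 1)))
      = ENNReal.ofReal (√(P.likelihood p.2 * Q.likelihood p.2)
          * √(P.labelProb z * Q.labelProb z)) := by
    intro z
    rw [fairProblem_labelProb, P.likelihood_snoc, Q.likelihood_snoc,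
      ← ENNReal.ofReal_mul (by norm_num)]
    congr 1
    rw [show P.likelihood p.2 * (2 * P.labelProb z) * (Q.likelihood p.2 * (2 * Q.labelProb z))
      = 2 ^ 2 * ((P.likelihood p.2 * Q.likelihood p.2) * (P.labelProb z * Q.labelProb z)) by ring,
      Real.sqrt_mul (by norm_num), Real.sqrt_sq (by norm_num),
      Real.sqrt_mul (mul_nonneg (P.likelihood_nonneg _) (Q.likelihood_nonneg _))]
    ring
  dsimp only
  rw [e, e, ← ENNReal.ofReal_add (by positivity) (by positivity), ← mul_add]
  rfl

lemma sqrt_mul_le_half_add {a b : ℝ} (ha : 0 ≤ a) (hb : 0 ≤ b) : √(a * b) ≤ (a + b) / 2 := by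
  rw [Real.sqrt_mul ha]
  nlinarith [Real.sq_sqrt ha, Real.sq_sqrt hb, sq_nonneg (√a - √b)]

/-- A query in `S` loses at most `δ √(L_P L_Q) ≤ (δ / 2) (L_P + L_Q)`, with `L_P`, `L_Q` the current
likelihoods. Integrated, this is `δ / 2` times the growth of the two expected counts, so the total
loss is linear in the counts. -/
lemma one_le_affinity_add (A : ActiveStrategy.{u} d n) (P Q : Problem d) {S : Set (Feature d)}
    (hS : MeasurableSet S) {δ : ℝ} (hδ : 0 ≤ δ)
    (hin : ∀ x, 1 - δ ≤ affinity P Q x) (hout : ∀ x, x ∉ S → 1 ≤ affinity P Q x) (t : ℕ) :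
    1 ≤ A.affinity P Q t
      + ENNReal.ofReal (δ / 2) * (A.expectedCount P S t + A.expectedCount Q S t) := by
  induction t with
  | zero =>
    have := isProbabilityMeasure_law A (fairProblem d) 0
    refine le_add_right ?_
    simp [ActiveStrategy.affinity, Problem.likelihood]
  | succ t ih =>
    have hmS := measurable_indicator_query A hS t
    have hmP := measurable_likelihood_snd A P t
    have hmQ := measurable_likelihood_snd A Q t
    have key : A.affinity P Q t ≤ A.affinity P Q (t + 1) + ENNReal.ofReal (δ / 2) *
        ((∫⁻ p, ENNReal.ofReal (P.likelihood p.2) * S.indicator 1 (A.query t p)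
          ∂(A.law (fairProblem d) t))
        + ∫⁻ p, ENNReal.ofReal (Q.likelihood p.2) * S.indicator 1 (A.query t p)
          ∂(A.law (fairProblem d) t)) := by
      rw [affinity_succ, ← lintegral_add_left (hmP.fun_mul hmS),
        ← lintegral_const_mul _ ((hmP.fun_mul hmS).fun_add (hmQ.fun_mul hmS)),
        ← lintegral_add_right _ (((hmP.fun_mul hmS).fun_add (hmQ.fun_mul hmS)).const_mul _)]
      refine lintegral_mono fun p => ?_
      have hs := Real.sqrt_nonneg (P.likelihood p.2 * Q.likelihood p.2)
      by_cases hx : A.query t p ∈ S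
      · simp only [hx, indicator_of_mem, Pi.one_apply, mul_one]
        rw [← ENNReal.ofReal_add (P.likelihood_nonneg _) (Q.likelihood_nonneg _),
          ← ENNReal.ofReal_mul (by positivity)]
        refine (ENNReal.ofReal_le_ofReal ?_).trans ENNReal.ofReal_add_le
        have h1 := sqrt_mul_le_half_add (P.likelihood_nonneg p.2) (Q.likelihood_nonneg p.2)
        have h2 := mul_le_mul_of_nonneg_left (hin (A.query t p)) hs
        have h3 := mul_le_mul_of_nonneg_left h1 hδ
        linarith
      · refine le_add_right (ENNReal.ofReal_le_ofReal ?_)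
        exact le_mul_of_one_le_right hs (hout _ hx)
    rw [expectedCount_succ A P hS, expectedCount_succ A Q hS]
    calc (1 : ℝ≥0∞) ≤ _ := ih
      _ ≤ _ := add_le_add_left key _
      _ = _ := by ring

/-- This is `(5√a - 3√b)^2 ≥ 0`. It replaces the Cauchy–Schwarz step of Le Cam's bound by a linear
inequality, so that query counts can later be averaged. -/
lemma sqrt_mul_le_of_left {a b : ℝ} (ha : 0 ≤ a) (hb : 0 ≤ b) :
    15 / 8 * √(a * b) ≤ a + 9 / 16 * (a + b) := by
  rw [Real.sqrt_mul ha]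
  nlinarith [Real.sq_sqrt ha, Real.sq_sqrt hb, sq_nonneg (5 * √a - 3 * √b)]

/-- The probability that the returned classifier takes the value `s` at `z`. -/
def ActiveStrategy.classifyProb (A : ActiveStrategy.{u} d n) (P : Problem d) (z : Feature d)
    (s : Bool) : ℝ≥0∞ :=
  A.law P n {h | A.classify h z = s}

lemma measurableSet_classify (A : ActiveStrategy.{u} d n) (z : Feature d) (s : Bool) :
    MeasurableSet {h | A.classify h z = s} :=
  (A.measurable_classify.comp (measurable_id.prodMk measurable_const))
    (measurableSet_singleton s)

lemma affinity_le_classifyProb (A : ActiveStrategy.{u} d n) (P Q : Problem d) (z : Feature d)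
    (s : Bool) :
    ENNReal.ofReal (15 / 8) * A.affinity P Q n
      ≤ A.classifyProb P z s + A.classifyProb Q z (!s) + ENNReal.ofReal (9 / 8) := by
  have hm := fun s => measurableSet_classify A z s
  have hmP := measurable_likelihood_snd A P n
  have hmQ := measurable_likelihood_snd A Q n
  have hone : ∀ R : Problem d, ∫⁻ p, ENNReal.ofReal (R.likelihood p.2)
      ∂(A.law (fairProblem d) n) = 1 := by
    intro R
    have := isProbabilityMeasure_law A R n
    have h := lintegral_law_eq A R n (Φ := fun _ => 1) measurable_const
    simpa using h.symm
  have hprob : ∀ (R : Problem d) s, A.classifyProb R z s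
      = ∫⁻ p, ENNReal.ofReal (R.likelihood p.2) * {h | A.classify h z = s}.indicator 1 p
        ∂(A.law (fairProblem d) n) := by
    intro R s
    rw [ActiveStrategy.classifyProb, ← lintegral_indicator_one (hm s),
      lintegral_law_eq A R n (measurable_one.indicator (hm s))]
  have h98 : ENNReal.ofReal (9 / 8) = ∫⁻ p, ENNReal.ofReal (9 / 16) *
      (ENNReal.ofReal (P.likelihood p.2) + ENNReal.ofReal (Q.likelihood p.2))
      ∂(A.law (fairProblem d) n) := by
    rw [lintegral_const_mul _ (hmP.fun_add hmQ), lintegral_add_left hmP, hone, hone,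
      one_add_one_eq_two, ← ENNReal.ofReal_ofNat 2, ← ENNReal.ofReal_mul (by norm_num)]
    norm_num
  have hmi := fun s => (measurable_one (α := ℝ≥0∞)).indicator (hm s)
  rw [h98, hprob, hprob, ActiveStrategy.affinity,
    ← lintegral_const_mul _ (measurable_sqrt_likelihood_mul A P Q n),
    ← lintegral_add_left (hmP.fun_mul (hmi s)),
    ← lintegral_add_left ((hmP.fun_mul (hmi s)).fun_add (hmQ.fun_mul (hmi (!s))))]
  refine lintegral_mono fun p => ?_
  have hP := P.likelihood_nonneg p.2
  have hQ := Q.likelihood_nonneg p.2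
  dsimp only
  rw [← ENNReal.ofReal_mul (by norm_num), ← ENNReal.ofReal_add hP hQ,
    ← ENNReal.ofReal_mul (by norm_num)]
  by_cases hs : A.classify p z = s
  · simp only [indicator, mem_ofPred_eq, hs, if_true, Pi.one_apply, mul_one]
    refine (ENNReal.ofReal_le_ofReal (sqrt_mul_le_of_left hP hQ)).trans ?_
    refine ENNReal.ofReal_add_le.trans ?_
    gcongr
    exact le_self_add
  · have hs' : A.classify p z = !s := by
      revert hs; cases A.classify p z <;> cases s <;> simp
    simp only [indicator, mem_ofPred_eq, hs', if_true, Pi.one_apply, mul_one]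
    -- The term `9/16 * (a + b)` is symmetric, so the same inequality serves with the two
    -- likelihoods exchanged.
    have h := sqrt_mul_le_of_left hQ hP
    rw [mul_comm, add_comm (Q.likelihood p.2) (P.likelihood p.2), mul_comm] at h
    rw [mul_comm (Q.likelihood p.2)] at h
    refine (ENNReal.ofReal_le_ofReal h).trans ?_
    refine ENNReal.ofReal_add_le.trans ?_
    gcongr
    exact le_add_self

lemma classifyProb_ne_top (A : ActiveStrategy.{u} d n) (P : Problem d) (z : Feature d) (s : Bool) :
    A.classifyProb P z s ≠ ∞ := by
  have := isProbabilityMeasure_law A P n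
  exact measure_ne_top _ _

/-- The constants are `15/8 - 9/8 = 3/4` and `15/8 * 1/2 = 15/16`. -/
lemma three_quarters_le (A : ActiveStrategy.{u} d n) (P Q : Problem d) {S : Set (Feature d)}
    (hS : MeasurableSet S) {δ : ℝ} (hδ : 0 ≤ δ)
    (hin : ∀ x, 1 - δ ≤ affinity P Q x) (hout : ∀ x, x ∉ S → 1 ≤ affinity P Q x)
    (hcP : A.expectedCount P S n ≠ ∞) (hcQ : A.expectedCount Q S n ≠ ∞)
    (z : Feature d) (s : Bool) :
    3 / 4 ≤ (A.classifyProb P z s).toReal + (A.classifyProb Q z (!s)).toReal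
      + 15 / 16 * δ * ((A.expectedCount P S n).toReal + (A.expectedCount Q S n).toReal) := by
  have h1 := one_le_affinity_add A P Q hS hδ hin hout n
  have h2 := affinity_le_classifyProb A P Q z s
  have hP := classifyProb_ne_top A P z s
  have hQ := classifyProb_ne_top A Q z (!s)
  rw [← ENNReal.ofReal_toReal hcP, ← ENNReal.ofReal_toReal hcQ] at h1
  rw [← ENNReal.ofReal_toReal hP, ← ENNReal.ofReal_toReal hQ,
    ← ENNReal.ofReal_add (by positivity) (by positivity),
    ← ENNReal.ofReal_add (by positivity) (by positivity)] at h2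
  have haff : A.affinity P Q n ≠ ∞ := by
    intro h
    rw [h, ENNReal.mul_top (by norm_num)] at h2
    exact absurd h2 (by simp)
  rw [← ENNReal.ofReal_toReal haff, ← ENNReal.ofReal_mul (by norm_num),
    ENNReal.ofReal_le_ofReal_iff (by positivity)] at h2
  rw [← ENNReal.ofReal_toReal haff, ← ENNReal.ofReal_add (by positivity) (by positivity),
    ← ENNReal.ofReal_mul (by positivity), ← ENNReal.ofReal_add (by positivity) (by positivity),
    ENNReal.one_le_ofReal] at h1
  linarith

/-! ### Averaging over a cube of problems -/

/-- Flipping coordinate `j` permutes the cube, so after summing over `σ` each pair contributes twice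
the same total. The counts cost at most `15/8 * 1/5 = 3/8` per coordinate on average, which leaves
`(3/4 - 3/8) / 2 = 3/16`. -/
lemma exists_sum_ge_of_flip {ι : Type*} [Fintype ι] [DecidableEq ι]
    (e N : (ι → Bool) → ι → ℝ) {δ B : ℝ} (hδ : 0 ≤ δ)
    (hpair : ∀ σ j, 3 / 4 ≤ e σ j + e (Function.update σ j (!σ j)) j
      + 15 / 16 * δ * (N σ j + N (Function.update σ j (!σ j)) j))
    (hN : ∀ σ, ∑ j, N σ j ≤ B) (hB : 5 * δ * B ≤ Fintype.card ι) :
    ∃ σ, 3 / 16 * (Fintype.card ι : ℝ) ≤ ∑ j, e σ j := by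
  have hflip : ∀ (F : (ι → Bool) → ι → ℝ) (j : ι),
      ∑ σ, F (Function.update σ j (!σ j)) j = ∑ σ, F σ j := by
    intro F j
    have hinv : Function.Involutive (fun σ : ι → Bool => Function.update σ j (!σ j)) := by
      intro σ; simp
    exact Equiv.sum_comp hinv.toPerm (fun σ => F σ j)
  have h1 : ∑ j : ι, ∑ _σ : ι → Bool, (3 / 4 : ℝ) ≤ ∑ j, ∑ σ, (e σ j
      + e (Function.update σ j (!σ j)) j
      + 15 / 16 * δ * (N σ j + N (Function.update σ j (!σ j)) j)) :=
    Finset.sum_le_sum fun j _ => Finset.sum_le_sum fun σ _ => hpair σ j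
  simp only [Finset.sum_add_distrib, ← Finset.mul_sum, hflip] at h1
  rw [Finset.sum_comm (f := fun j σ => e σ j), Finset.sum_comm (f := fun j σ => N σ j)] at h1
  have h2 : ∑ σ, ∑ j, N σ j ≤ ∑ _σ : ι → Bool, B := Finset.sum_le_sum fun σ _ => hN σ
  simp only [Finset.sum_const, Finset.card_univ, nsmul_eq_mul] at h1 h2
  set M : ℝ := (Fintype.card (ι → Bool) : ℝ) with hM
  have hM0 : 0 ≤ M := by positivity
  have h3 : ∑ _σ : ι → Bool, (3 / 16 * (Fintype.card ι : ℝ)) ≤ ∑ σ, ∑ j, e σ j := by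
    simp only [Finset.sum_const, Finset.card_univ, nsmul_eq_mul]
    have h4 := mul_le_mul_of_nonneg_left h2 hδ
    have h5 := mul_le_mul_of_nonneg_left hB hM0
    nlinarith
  obtain ⟨σ, _, hσ⟩ := Finset.exists_le_of_sum_le Finset.univ_nonempty h3
  exact ⟨σ, hσ⟩

/-- Assouad's lemma for active strategies: the `n` queries are shared among disjoint sets `S j`, so
the expected counts sum to at most `n` whatever the strategy does. -/
theorem exists_le_expectedExcessRisk {ι : Type*} [Fintype ι] [DecidableEq ι]
    (A : ActiveStrategy.{u} d n) (P : (ι → Bool) → Problem d) (S : ι → Set (Feature d))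
    (hS : ∀ j, MeasurableSet (S j)) (hdisj : Pairwise (Function.onFun Disjoint S))
    (z : ι → Feature d) {δ v : ℝ} (hδ : 0 ≤ δ) (hv : 0 ≤ v)
    (hin : ∀ σ j x, 1 - δ ≤ affinity (P σ) (P (Function.update σ j (!σ j))) x)
    (hout : ∀ σ j x, x ∉ S j → 1 ≤ affinity (P σ) (P (Function.update σ j (!σ j))) x)
    (hex : ∀ σ f, Measurable f →
      v * ∑ j, (if f (z j) = σ j then 1 else 0) ≤ (P σ).excessRisk f)
    (hn : 5 * δ * n ≤ Fintype.card ι) :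
    ∃ σ, ENNReal.ofReal (v * (3 / 16 * Fintype.card ι)) ≤ A.expectedExcessRisk (P σ) := by
  have hcount : ∀ σ j, A.expectedCount (P σ) (S j) n ≠ ∞ := fun σ j => by
    refine ne_top_of_le_ne_top (ENNReal.natCast_ne_top n)
      (le_trans ?_ (sum_expectedCount_le A (P σ) hS hdisj n))
    exact Finset.single_le_sum (f := fun j => A.expectedCount (P σ) (S j) n)
      (fun _ _ => zero_le) (Finset.mem_univ j)
  obtain ⟨σ, hσ⟩ := exists_sum_ge_of_flip
    (fun σ j => (A.classifyProb (P σ) (z j) (σ j)).toReal)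
    (fun σ j => (A.expectedCount (P σ) (S j) n).toReal) (B := n) hδ
    (fun σ j => by
      have h := three_quarters_le A (P σ) (P (Function.update σ j (!σ j))) (hS j) hδ (hin σ j)
        (hout σ j) (hcount _ _) (hcount _ _) (z j) (σ j)
      simpa using h)
    (fun σ => by
      rw [← ENNReal.toReal_sum fun j _ => hcount σ j]
      exact ENNReal.toReal_le_of_le_ofReal (by positivity)
        (by simpa using sum_expectedCount_le A (P σ) hS hdisj n)) hn
  refine ⟨σ, ?_⟩
  have hm := fun j => measurableSet_classify A (z j) (σ j)
  calc ENNReal.ofReal (v * (3 / 16 * Fintype.card ι))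
      ≤ ENNReal.ofReal (v * ∑ j, (A.classifyProb (P σ) (z j) (σ j)).toReal) :=
        ENNReal.ofReal_le_ofReal (mul_le_mul_of_nonneg_left hσ hv)
    _ = ENNReal.ofReal v * ∑ j, A.classifyProb (P σ) (z j) (σ j) := by
        rw [ENNReal.ofReal_mul hv, ENNReal.ofReal_sum_of_nonneg fun _ _ => ENNReal.toReal_nonneg]
        congr 1
        exact Finset.sum_congr rfl fun j _ => ENNReal.ofReal_toReal (classifyProb_ne_top A _ _ _)
    _ = ∫⁻ h, ENNReal.ofReal v * ∑ j, {h | A.classify h (z j) = σ j}.indicator 1 h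
          ∂(A.law (P σ) n) := by
        rw [lintegral_const_mul _
          (Finset.measurable_sum _ fun j _ => measurable_one.indicator (hm j)),
          lintegral_finsetSum _ fun j _ => measurable_one.indicator (hm j)]
        congr 1
        exact Finset.sum_congr rfl fun j _ => (lintegral_indicator_one (hm j)).symm
    _ ≤ A.expectedExcessRisk (P σ) := by
        refine lintegral_mono fun h => ?_
        have hf : Measurable (A.classify h) :=
          A.measurable_classify.comp (measurable_const.prodMk measurable_id)
        refine le_trans (le_of_eq ?_) (ENNReal.ofReal_le_ofReal (hex σ _ hf))
        rw [ENNReal.ofReal_mul hv, ENNReal.ofReal_sum_of_nonneg fun _ _ => by split_ifs <;> norm_num]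
        congr 1
        refine Finset.sum_congr rfl fun j _ => ?_
        by_cases hj : A.classify h (z j) = σ j <;> simp [hj]

end Histories

/-! ### Risks -/

variable {d : ℕ}

lemma Problem.labelKernel_apply_ne (P : Problem d) (x : Feature d) (s : Bool) :
    P.labelKernel x {y | y ≠ s} = ENNReal.ofReal (P.labelProb (x, !s)) := by
  rw [← lintegral_indicator_one ({y | y ≠ s}.toFinite.measurableSet), P.lintegral_labelKernel]
  cases s <;> simp

lemma Problem.measurable_labelProb_comp (P : Problem d) {f : Feature d → Bool}
    (hf : Measurable f) : Measurable fun x => P.labelProb (x, f x) :=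
  P.measurable_labelProb.comp (measurable_id.prodMk hf)

lemma Problem.risk_eq (P : Problem d) {f : Feature d → Bool} (hf : Measurable f) :
    P.risk f = ∫ x, P.labelProb (x, !f x) ∂P.PX := by
  have := P.isProb
  have hf' : Measurable fun x => !f x := (measurable_of_countable (fun b : Bool => !b)).comp hf
  have hs : MeasurableSet {z : Feature d × Bool | z.2 ≠ f z.1} :=
    (measurableSet_eq_fun measurable_snd (hf.comp measurable_fst)).compl
  rw [Problem.risk, Problem.joint, measureReal_def, Measure.compProd_apply hs,
    integral_eq_lintegral_of_nonneg_ae (ae_of_all _ fun x => P.labelProb_nonneg _)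
      (P.measurable_labelProb_comp hf').aestronglyMeasurable]
  congr 1
  exact lintegral_congr fun x => P.labelKernel_apply_ne x (f x)

lemma Problem.measurable_bayes (P : Problem d) : Measurable P.bayes := by
  refine measurable_to_bool ?_
  have : P.bayes ⁻¹' {true} = {x | 1 / 2 ≤ P.η x} := by
    ext x; simp [Problem.bayes]
  rw [this]
  exact measurableSet_le measurable_const P.measurable_η

lemma Problem.labelProb_bayes_le (P : Problem d) (x : Feature d) (s : Bool) :
    P.labelProb (x, !P.bayes x) ≤ P.labelProb (x, !s) := by
  by_cases h : 1 / 2 ≤ P.η x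
  · rw [show P.bayes x = true by simpa [Problem.bayes] using h]
    cases s <;> simp [Problem.labelProb]
    linarith
  · rw [show P.bayes x = false by simpa [Problem.bayes] using h]
    cases s <;> simp [Problem.labelProb]
    linarith

/-! ### The grid of problems -/

lemma continuous_tilde : Continuous (Feature.tilde : Feature d → Fin (d - 1) → ℝ) :=
  continuous_pi fun i => continuous_subtype_val.comp ((continuous_apply i).comp continuous_fst)

lemma continuous_last : Continuous (Feature.last : Feature d → ℝ) :=
  continuous_subtype_val.comp continuous_snd

/-- The point at height `b` over the centre of the `j`-th of the `K^(d-1)` cells of the grid. -/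
def gridPoint {K : ℕ} (b : unitInterval) (j : Fin (d - 1) → Fin K) : Feature d :=
  (fun i => ⟨((j i : ℝ) + 1 / 2) / K, by
    have h : ((j i : ℕ) : ℝ) + 1 ≤ K := by exact_mod_cast (j i).2
    have h0 : (0 : ℝ) ≤ (j i : ℕ) := Nat.cast_nonneg _
    exact ⟨by positivity, div_le_one_of_le₀ (by linarith) (by linarith)⟩⟩, b)

lemma smul_tilde_gridPoint {K : ℕ} (b : unitInterval) (j : Fin (d - 1) → Fin K) :
    (K : ℝ) • (gridPoint b j : Feature d).tilde = cellCenter j := by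
  ext i
  have h : (K : ℝ) ≠ 0 := by
    have := (j i).pos
    positivity
  simp only [Pi.smul_apply, Feature.tilde, gridPoint, cellCenter, smul_eq_mul]
  field_simp

/-- The marginal law with mass `w` spread over the grid points and `1 - w` at the origin. -/
def gridLaw (d K : ℕ) (b : unitInterval) (w : ℝ) : Measure (Feature d) :=
  ENNReal.ofReal (1 - w) • Measure.dirac (fun _ => 0, 0)
    + ∑ j : Fin (d - 1) → Fin K, ENNReal.ofReal (w / (K : ℝ) ^ (d - 1)) •
        Measure.dirac (gridPoint b j)

lemma isProbabilityMeasure_gridLaw {K : ℕ} (hK : 1 ≤ K) (b : unitInterval) {w : ℝ}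
    (hw0 : 0 ≤ w) (hw1 : w ≤ 1) : IsProbabilityMeasure (gridLaw d K b w) := by
  have hK' : (0 : ℝ) < K := by exact_mod_cast hK
  refine ⟨?_⟩
  simp only [gridLaw, Measure.coe_add, Measure.coe_smul, Pi.add_apply, Pi.smul_apply, smul_eq_mul,
    measure_univ, mul_one, Measure.finsetSum_apply, Finset.sum_const, Finset.card_univ,
    Fintype.card_fun, Fintype.card_fin, nsmul_eq_mul]
  rw [← ENNReal.ofReal_natCast, ← ENNReal.ofReal_mul (by positivity),
    ← ENNReal.ofReal_add (by linarith) (by positivity), ENNReal.ofReal_eq_one]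
  push_cast
  field_simp
  ring

lemma integral_gridLaw {K : ℕ} (b : unitInterval) {w : ℝ} (hw0 : 0 ≤ w) (hw1 : w ≤ 1)
    (F : Feature d → ℝ) :
    ∫ x, F x ∂(gridLaw d K b w) = (1 - w) * F (fun _ => 0, 0)
      + w / (K : ℝ) ^ (d - 1) * ∑ j : Fin (d - 1) → Fin K, F (gridPoint b j) := by
  have hi : ∀ z : Feature d, Integrable F (Measure.dirac z) := fun z =>
    integrable_dirac (by simp)
  rw [gridLaw, integral_add_measure ((hi _).smul_measure ENNReal.ofReal_ne_top)
    (integrable_finsetSum_measure.2 fun j _ => (hi _).smul_measure ENNReal.ofReal_ne_top),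
    integral_finsetSum_measure fun j _ => (hi _).smul_measure ENNReal.ofReal_ne_top]
  simp only [integral_smul_measure, integral_dirac, smul_eq_mul]
  rw [ENNReal.toReal_ofReal (by linarith), ENNReal.toReal_ofReal (by positivity), Finset.mul_sum]

/-- The parameters of a grid of classification problems, with the smallness conditions under
which its members belong to the problem class. -/
structure GridParam (d : ℕ) (lam α c κ C₃ Δ₀ κ' : ℝ) where
  K : ℕ
  b : unitInterval
  h : ℝ
  w : ℝ
  one_le_K : 1 ≤ K
  c_pos : 0 < c
  one_lt_κ : 1 < κ
  κ'_nonneg : 0 ≤ κ'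
  C₃_nonneg : 0 ≤ C₃
  half_le_b : 1 / 2 ≤ (b : ℝ)
  h_pos : 0 < h
  Δ₀_lt : Δ₀ < b - h
  noise_le : c * ((b : ℝ) + 2 * h) ^ (κ - 1) ≤ 1 / 2
  w_nonneg : 0 ≤ w
  w_le_one : w ≤ 1
  mass_eq : w * (2 * (c * (2 * h) ^ (κ - 1))) = C₃ * h ^ κ'
  isHolder : ∀ σ : (Fin (d - 1) → Fin K) → Bool, IsHolder lam α (bumpBoundary b h σ)

namespace GridParam

variable {lam α c κ C₃ Δ₀ κ' : ℝ} (G : GridParam d lam α c κ C₃ Δ₀ κ')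

/-- The boundary of the problem with signs `σ`. -/
def boundary (σ : (Fin (d - 1) → Fin G.K) → Bool) : (Fin (d - 1) → ℝ) → ℝ :=
  bumpBoundary (G.b : ℝ) G.h σ

/-- The distance of the regression function from `1/2` at height `y`. -/
def margin (y : ℝ) : ℝ := c * (|y - G.b| + 2 * G.h) ^ (κ - 1)

/-- The regression function of the problem with signs `σ`. -/
def eta (σ : (Fin (d - 1) → Fin G.K) → Bool) (x : Feature d) : ℝ :=
  if G.boundary σ x.tilde ≤ x.last then 1 / 2 + G.margin x.last else 1 / 2 - G.margin x.last

lemma abs_boundary_sub_le (σ : (Fin (d - 1) → Fin G.K) → Bool) (x : Fin (d - 1) → ℝ) :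
    |G.boundary σ x - G.b| ≤ G.h :=
  abs_bumpBoundary_sub_le G.h_pos.le σ x

lemma continuous_boundary (σ : (Fin (d - 1) → Fin G.K) → Bool) : Continuous (G.boundary σ) :=
  (contDiff_bumpBoundary (n := 0) _ _ σ).continuous

lemma boundary_gridPoint (σ : (Fin (d - 1) → Fin G.K) → Bool) (j : Fin (d - 1) → Fin G.K) :
    G.boundary σ (gridPoint G.b j : Feature d).tilde = G.b + G.h * bitSign (σ j) := by
  rw [boundary, bumpBoundary, smul_tilde_gridPoint, bumpSum_cellCenter]

lemma margin_pos (y : ℝ) : 0 < G.margin y :=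
  mul_pos G.c_pos (Real.rpow_pos_of_pos (by linarith [abs_nonneg (y - G.b), G.h_pos]) _)

/-- Since `1/2 ≤ b`, no height in `[0,1]` is farther from `b` than `0` is. -/
lemma margin_le_half {y : ℝ} (hy : y ∈ Icc (0 : ℝ) 1) : G.margin y ≤ 1 / 2 := by
  refine le_trans ?_ G.noise_le
  have h1 := G.h_pos
  have h2 : |y - G.b| ≤ G.b := abs_le.2 ⟨by linarith [hy.1], by linarith [hy.2, G.half_le_b]⟩
  have h3 := G.one_lt_κ
  exact mul_le_mul_of_nonneg_left (Real.rpow_le_rpow (by positivity) (by linarith) (by linarith))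
    G.c_pos.le

lemma margin_le_of_near {y : ℝ} (hy : |y - G.b| ≤ G.h) :
    G.margin y ≤ c * (3 * G.h) ^ (κ - 1) := by
  have h1 := G.h_pos
  have h3 := G.one_lt_κ
  exact mul_le_mul_of_nonneg_left (Real.rpow_le_rpow (by positivity) (by linarith) (by linarith))
    G.c_pos.le

lemma last_mem (x : Feature d) : x.last ∈ Icc (0 : ℝ) 1 := x.2.2

/-- The problem with signs `σ`. -/
def problem (σ : (Fin (d - 1) → Fin G.K) → Bool) : Problem d where
  PX := gridLaw d G.K G.b G.w
  isProb := isProbabilityMeasure_gridLaw G.one_le_K _ G.w_nonneg G.w_le_one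
  η := G.eta σ
  measurable_η := by
    have hm : Measurable fun x : Feature d => G.margin x.last := by
      unfold margin
      have := (continuous_last (d := d)).measurable
      fun_prop
    exact Measurable.ite
      (measurableSet_le ((G.continuous_boundary σ).comp continuous_tilde).measurable
        continuous_last.measurable) (measurable_const.add hm) (measurable_const.sub hm)
  η_mem := fun x => by
    have h1 := G.margin_pos x.last
    have h2 := G.margin_le_half (last_mem x)
    unfold eta
    split_ifs <;> constructor <;> linarith

lemma abs_eta_sub_half (σ : (Fin (d - 1) → Fin G.K) → Bool) (x : Feature d) :
    |G.eta σ x - 1 / 2| = G.margin x.last := by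
  have h1 := G.margin_pos x.last
  unfold eta
  split_ifs
  · rw [add_sub_cancel_left, abs_of_pos h1]
  · rw [sub_sub_cancel_left, abs_neg, abs_of_pos h1]

lemma half_le_eta_iff (σ : (Fin (d - 1) → Fin G.K) → Bool) (x : Feature d) :
    1 / 2 ≤ G.eta σ x ↔ G.boundary σ x.tilde ≤ x.last := by
  have h1 := G.margin_pos x.last
  unfold eta
  split_ifs with h
  · simp only [h, iff_true]; linarith
  · simp only [h, iff_false]; linarith

lemma margin_b : G.margin G.b = c * (2 * G.h) ^ (κ - 1) := by simp [margin]

lemma last_gridPoint (j : Fin (d - 1) → Fin G.K) :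
    (gridPoint G.b j : Feature d).last = G.b := rfl

/-- As a function of `Δ` the integral is a single step: the origin stays outside the strip, and all
grid points enter at `Δ = h`, where `mass_eq` gives exactly `C₃ h^κ'`. -/
lemma strip_integral_le (σ : (Fin (d - 1) → Fin G.K) → Bool) {Δ : ℝ} (hΔ : Δ ∈ Icc 0 Δ₀) :
    ∫ x in {x : Feature d | |x.last - G.boundary σ x.tilde| ≤ Δ}, |1 - 2 * (G.problem σ).η x|
      ∂(G.problem σ).PX ≤ C₃ * Δ ^ κ' := by
  have hh := G.h_pos
  have hs : MeasurableSet {x : Feature d | |x.last - G.boundary σ x.tilde| ≤ Δ} :=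
    measurableSet_le (continuous_last.sub
      ((G.continuous_boundary σ).comp continuous_tilde)).abs.measurable measurable_const
  have h2 : ∀ x, |1 - 2 * G.eta σ x| = 2 * G.margin x.last := by
    intro x
    rw [← G.abs_eta_sub_half σ, ← abs_of_pos (zero_lt_two (α := ℝ)), ← abs_mul,
      abs_of_pos (zero_lt_two (α := ℝ)), ← abs_neg]
    congr 1; ring
  rw [← integral_indicator hs]
  change ∫ x, _ ∂(gridLaw d G.K G.b G.w) ≤ _
  rw [integral_gridLaw G.b G.w_nonneg G.w_le_one]
  have horigin : ((fun _ => 0, 0) : Feature d) ∉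
      {x : Feature d | |x.last - G.boundary σ x.tilde| ≤ Δ} := by
    intro hx
    have h3 := (abs_le.1 (mem_ofPred.1 hx)).1
    have h4 := (abs_le.1 (G.abs_boundary_sub_le σ (Feature.tilde ((fun _ => 0, 0) : Feature d)))).1
    have h5 : Feature.last ((fun _ => 0, 0) : Feature d) = 0 := rfl
    rw [h5] at h3
    linarith [G.Δ₀_lt, hΔ.2]
  rw [indicator_of_notMem horigin, mul_zero, zero_add]
  have hgrid : ∀ j : Fin (d - 1) → Fin G.K,
      |(gridPoint G.b j : Feature d).last - G.boundary σ (gridPoint G.b j : Feature d).tilde|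
        = G.h := by
    intro j
    rw [G.boundary_gridPoint, last_gridPoint, sub_add_cancel_left, abs_neg, abs_mul, abs_bitSign,
      mul_one, abs_of_pos hh]
  rcases lt_or_ge Δ G.h with hlt | hge
  · rw [Finset.sum_eq_zero fun j _ => indicator_of_notMem (by
      rw [mem_ofPred, hgrid]; exact not_le.2 hlt) _, mul_zero]
    exact mul_nonneg G.C₃_nonneg (Real.rpow_nonneg hΔ.1 _)
  · have hK' : (0 : ℝ) < G.K := by exact_mod_cast G.one_le_K
    rw [Finset.sum_congr rfl fun j _ => indicator_of_mem (by
      rw [mem_ofPred, hgrid]; exact hge) _]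
    change G.w / (G.K : ℝ) ^ (d - 1) * ∑ j, |1 - 2 * G.eta σ (gridPoint G.b j)| ≤ _
    simp only [h2, last_gridPoint, margin_b, Finset.sum_const, Finset.card_univ, Fintype.card_fun,
      Fintype.card_fin, nsmul_eq_mul]
    push_cast
    rw [← mul_assoc, div_mul_cancel₀ _ (by positivity), G.mass_eq]
    exact mul_le_mul_of_nonneg_left (Real.rpow_le_rpow hh.le hge G.κ'_nonneg) G.C₃_nonneg

lemma problem_mem (σ : (Fin (d - 1) → Fin G.K) → Bool) :
    G.problem σ ∈ problemClass d lam α c κ C₃ Δ₀ κ' := by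
  refine ⟨G.boundary σ, G.isHolder σ, ?_, fun x => ?_, fun Δ hΔ => G.strip_integral_le σ hΔ⟩
  · ext x
    exact G.half_le_eta_iff σ x
  · change _ ≤ |G.eta σ x - 1 / 2|
    rw [abs_eta_sub_half]
    have h1 := abs_sub_le x.last G.b (G.boundary σ x.tilde)
    have h2 := G.abs_boundary_sub_le σ x.tilde
    rw [abs_sub_comm] at h2
    exact mul_le_mul_of_nonneg_left (Real.rpow_le_rpow (abs_nonneg _) (by linarith [G.h_pos])
      (by linarith [G.one_lt_κ])) G.c_pos.le

/-- A positive bump puts the grid point below the boundary, so the Bayes label is `!σ j` and `f = σ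
j` is the error. It costs twice the margin times the mass of the atom. -/
lemma le_excessRisk (σ : (Fin (d - 1) → Fin G.K) → Bool) {f : Feature d → Bool}
    (hf : Measurable f) :
    C₃ * G.h ^ κ' / (G.K : ℝ) ^ (d - 1) *
      ∑ j, (if f (gridPoint G.b j) = σ j then 1 else 0) ≤ (G.problem σ).excessRisk f := by
  set P := G.problem σ with hP
  have hrisk : ∀ f : Feature d → Bool, Measurable f → P.risk f
      = (1 - G.w) * P.labelProb ((fun _ => 0, 0), !f (fun _ => 0, 0))
        + G.w / (G.K : ℝ) ^ (d - 1) * ∑ j : Fin (d - 1) → Fin G.K,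
            P.labelProb (gridPoint G.b j, !f (gridPoint G.b j)) := by
    intro f hf
    rw [P.risk_eq hf]
    exact integral_gridLaw G.b G.w_nonneg G.w_le_one _
  have hbayes : ∀ j, P.bayes (gridPoint G.b j) = !σ j := by
    intro j
    have h1 : P.bayes (gridPoint G.b j) = true ↔ 1 / 2 ≤ G.eta σ (gridPoint G.b j) := by
      simp [Problem.bayes, hP, problem]
    rw [half_le_eta_iff, boundary_gridPoint, last_gridPoint] at h1
    have hh := G.h_pos
    cases hσ : σ j
    · rw [Bool.not_false, h1, hσ]; simp [bitSign, hh.le]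
    · rw [Bool.not_true, ← Bool.not_eq_true, h1, hσ]; simp [bitSign, hh]
  have hterm : ∀ j, 2 * (c * (2 * G.h) ^ (κ - 1)) * (if f (gridPoint G.b j) = σ j then 1 else 0)
      ≤ P.labelProb (gridPoint G.b j, !f (gridPoint G.b j))
        - P.labelProb (gridPoint G.b j, !P.bayes (gridPoint G.b j)) := by
    intro j
    split_ifs with hj
    · have h1 := G.abs_eta_sub_half σ (gridPoint G.b j)
      have h2 := G.half_le_eta_iff σ (gridPoint G.b j)
      rw [last_gridPoint, margin_b] at h1
      rw [boundary_gridPoint, last_gridPoint] at h2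
      have hh := G.h_pos
      rw [hbayes, hj, Bool.not_not]
      change _ ≤ (if (!σ j) = true then G.eta σ (gridPoint G.b j)
          else 1 - G.eta σ (gridPoint G.b j))
        - (if σ j = true then G.eta σ (gridPoint G.b j) else 1 - G.eta σ (gridPoint G.b j))
      cases hσ : σ j
      · have h3 : 1 / 2 ≤ G.eta σ (gridPoint G.b j) := h2.2 (by rw [hσ]; simp [bitSign, hh.le])
        rw [abs_of_nonneg (by linarith)] at h1
        simp
        linarith
      · have h3 : ¬ 1 / 2 ≤ G.eta σ (gridPoint G.b j) := by
          rw [h2, hσ]; simp [bitSign, hh]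
        rw [abs_of_neg (by linarith)] at h1
        simp
        linarith
    · rw [mul_zero, sub_nonneg]
      exact P.labelProb_bayes_le _ _
  have hK' : (0 : ℝ) < G.K := by exact_mod_cast G.one_le_K
  have hw := G.w_nonneg
  rw [Problem.excessRisk, hrisk f hf, hrisk _ P.measurable_bayes, ← G.mass_eq]
  have h0 := mul_le_mul_of_nonneg_left (P.labelProb_bayes_le (fun _ => 0, 0) (f (fun _ => 0, 0)))
    (sub_nonneg.2 G.w_le_one)
  have hsum := mul_le_mul_of_nonneg_left (Finset.sum_le_sum fun j (_ : j ∈ Finset.univ) => hterm j)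
    (by positivity : 0 ≤ G.w / (G.K : ℝ) ^ (d - 1))
  rw [← Finset.mul_sum, Finset.sum_sub_distrib, mul_sub] at hsum
  calc _ = G.w / (G.K : ℝ) ^ (d - 1) * (2 * (c * (2 * G.h) ^ (κ - 1)) *
        ∑ j, (if f (gridPoint G.b j) = σ j then 1 else 0)) := by ring
    _ ≤ _ := by linarith

/-- The part of the feature space above the `j`-th cell. -/
def column (j : Fin (d - 1) → Fin G.K) : Set (Feature d) :=
  {x | ‖(G.K : ℝ) • x.tilde - cellCenter j‖ < 1 / 4}

lemma measurableSet_column (j : Fin (d - 1) → Fin G.K) : MeasurableSet (G.column j) := by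
  have h : Continuous fun x : Feature d => ‖(G.K : ℝ) • x.tilde - cellCenter j‖ := by
    have := continuous_tilde (d := d)
    fun_prop
  exact measurableSet_lt h.measurable measurable_const

lemma pairwise_disjoint_column : Pairwise (Function.onFun Disjoint G.column) := by
  intro i j hij
  refine Set.disjoint_left.2 fun x hi hj => hij ?_
  exact cellCenter_inj (le_of_lt hi) (le_of_lt hj)

lemma affinity_of_eta_eq {σ τ : (Fin (d - 1) → Fin G.K) → Bool} {x : Feature d}
    (h : G.eta σ x = G.eta τ x) : affinity (G.problem σ) (G.problem τ) x = 1 := by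
  have e : ∀ y, (G.problem τ).labelProb (x, y) = (G.problem σ).labelProb (x, y) := by
    intro y
    simp [Problem.labelProb, problem, h]
  rw [affinity, e, e, Real.sqrt_mul_self (Problem.labelProb_nonneg _ _),
    Real.sqrt_mul_self (Problem.labelProb_nonneg _ _)]
  simp [Problem.labelProb]

lemma one_le_affinity_of_notMem_column (σ : (Fin (d - 1) → Fin G.K) → Bool)
    (j : Fin (d - 1) → Fin G.K) (s : Bool) {x : Feature d} (hx : x ∉ G.column j) :
    1 ≤ affinity (G.problem σ) (G.problem (Function.update σ j s)) x := by
  refine (G.affinity_of_eta_eq ?_).ge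
  have h : G.boundary (Function.update σ j s) x.tilde = G.boundary σ x.tilde := by
    rw [boundary, boundary, bumpBoundary, bumpBoundary, bumpSum_update σ j s (not_lt.1 hx)]
  simp only [eta, h]

/-- Regression functions that differ at `x` take the values `1/2 ± M` there, and `x_d` lies between
two boundaries, hence within `h` of `b`. The affinity is then `√(1 - 4M^2) ≥ 1 - 4M^2`. -/
lemma le_affinity (σ τ : (Fin (d - 1) → Fin G.K) → Bool) (x : Feature d) :
    1 - 4 * (c * (3 * G.h) ^ (κ - 1)) ^ 2 ≤ affinity (G.problem σ) (G.problem τ) x := by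
  by_cases h : G.eta σ x = G.eta τ x
  · rw [G.affinity_of_eta_eq h]
    nlinarith [sq_nonneg (c * (3 * G.h) ^ (κ - 1))]
  have hm0 := G.margin_pos x.last
  have hm1 := G.margin_le_half (last_mem x)
  have hnear : |x.last - G.b| ≤ G.h := by
    have h1 := abs_le.1 (G.abs_boundary_sub_le σ x.tilde)
    have h2 := abs_le.1 (G.abs_boundary_sub_le τ x.tilde)
    unfold eta at h
    rw [abs_le]
    split_ifs at h with h3 h4 h4
    · exact absurd rfl h
    · push Not at h4; constructor <;> linarith
    · push Not at h3; constructor <;> linarith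
    · exact absurd rfl h
  have hmle := G.margin_le_of_near hnear
  set M := G.margin x.last with hM
  have hsq : M ^ 2 ≤ (c * (3 * G.h) ^ (κ - 1)) ^ 2 := pow_le_pow_left₀ hm0.le hmle 2
  have hp : 0 ≤ (1 / 2 + M) * (1 / 2 - M) := mul_nonneg (by linarith) (by linarith)
  have hroot : 1 - 4 * M ^ 2 ≤ 2 * √((1 / 2 + M) * (1 / 2 - M)) := by
    have h1 := Real.sq_sqrt hp
    have h2 := Real.sqrt_nonneg ((1 / 2 + M) * (1 / 2 - M))
    have h3 : √((1 / 2 + M) * (1 / 2 - M)) ≤ 1 / 2 := by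
      rw [Real.sqrt_le_left (by norm_num)]
      nlinarith
    nlinarith
  have haff : affinity (G.problem σ) (G.problem τ) x = 2 * √((1 / 2 + M) * (1 / 2 - M)) := by
    change √(G.eta σ x * G.eta τ x) + √((1 - G.eta σ x) * (1 - G.eta τ x)) = _
    unfold eta at h ⊢
    rw [← hM] at h ⊢
    split_ifs at h ⊢
    · exact absurd rfl h
    · rw [two_mul]; congr 2; ring
    · rw [two_mul]; congr 2 <;> ring
    · exact absurd rfl h
  rw [haff]
  linarith

theorem le_minimaxRisk {n : ℕ}
    (hn : 5 * (4 * (c * (3 * G.h) ^ (κ - 1)) ^ 2) * n ≤ (G.K : ℝ) ^ (d - 1)) :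
    ENNReal.ofReal (3 / 16 * (C₃ * G.h ^ κ')) ≤
      minimaxRisk.{u} n (problemClass d lam α c κ C₃ Δ₀ κ') := by
  have hK' : (0 : ℝ) < G.K := by exact_mod_cast G.one_le_K
  refine le_iInf fun A => ?_
  -- All problems of the grid share this marginal, so they all face the same strategy.
  obtain ⟨σ, hσ⟩ := exists_le_expectedExcessRisk (A (gridLaw d G.K G.b G.w)) G.problem G.column
    G.measurableSet_column G.pairwise_disjoint_column (gridPoint G.b)
    (δ := 4 * (c * (3 * G.h) ^ (κ - 1)) ^ 2) (v := C₃ * G.h ^ κ' / (G.K : ℝ) ^ (d - 1))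
    (by positivity)
    (div_nonneg (mul_nonneg G.C₃_nonneg (Real.rpow_nonneg G.h_pos.le _)) (by positivity))
    (fun σ j x => G.le_affinity _ _ x)
    (fun σ j x hx => G.one_le_affinity_of_notMem_column σ j _ hx)
    (fun σ f hf => G.le_excessRisk σ hf) (by simpa using hn)
  refine le_trans (le_of_eq ?_) (hσ.trans (le_iSup₂_of_le (G.problem σ) (G.problem_mem σ) le_rfl))
  congr 1
  simp only [Fintype.card_fun, Fintype.card_fin]
  push_cast
  field_simp

end GridParam

/-! ### The minimax lower bound -/

/-- By continuity the strict inequality at `max (1/2) Δ₀` survives slightly above it. -/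
lemma exists_base_level {c κ Δ₀ : ℝ} (hκ : 1 < κ) (hΔ₀_lt : Δ₀ < 1)
    (hcΔ : c * (max (1 / 2) Δ₀) ^ (κ - 1) < 1 / 2) :
    ∃ b : ℝ, max (1 / 2) Δ₀ < b ∧ b < 1 ∧ c * b ^ (κ - 1) < 1 / 2 := by
  set a := max (1 / 2) Δ₀ with ha
  have ha1 : a < 1 := max_lt (by norm_num) hΔ₀_lt
  have hcont : Filter.Tendsto (fun b : ℝ => c * b ^ (κ - 1)) (nhdsWithin a (Ioi a))
      (nhds (c * a ^ (κ - 1))) :=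
    ((Real.continuous_rpow_const (by linarith)).const_mul c).continuousAt.tendsto.mono_left
      nhdsWithin_le_nhds
  have hmem : ∀ᶠ b in nhdsWithin a (Ioi a), b ∈ Ioo a 1 := Ioo_mem_nhdsGT ha1
  obtain ⟨b, ⟨hb1, hb2⟩, hb3⟩ := (hmem.and (hcont.eventually_lt_const hcΔ)).exists
  exact ⟨b, hb1, hb2, hb3⟩

/-- Every condition holds strictly in the limit `h → 0`; the last one, which bounds the mass `w`,
uses `κ - 1 < κ'`. Those quantified over `h` are needed because the actual height shrinks with `n`.
-/
lemma exists_height {b c κ κ' C₃ Δ₀ A : ℝ} (hκ : 1 < κ) (hκ' : κ - 1 < κ')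
    (hbΔ : Δ₀ < b) (hb : b < 1) (hcb : c * b ^ (κ - 1) < 1 / 2) :
    ∃ h₀ : ℝ, 0 < h₀ ∧ A * h₀ ≤ 1 ∧ 20 * (c * (3 * h₀) ^ (κ - 1)) ^ 2 ≤ 1 ∧
      ∀ h ∈ Ioc 0 h₀, b + h ≤ 1 ∧ Δ₀ < b - h ∧ c * (b + 2 * h) ^ (κ - 1) ≤ 1 / 2 ∧
        C₃ * h ^ (κ' - (κ - 1)) / (2 * c * 2 ^ (κ - 1)) ≤ 1 := by
  have hκ0 : 0 < κ - 1 := by linarith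
  have hκ'0 : 0 < κ' - (κ - 1) := by linarith
  have hlim : ∀ {F : ℝ → ℝ} {r : ℝ}, Continuous F → F 0 < r →
      ∀ᶠ h in nhdsWithin (0 : ℝ) (Ioi 0), F h < r := fun hF h0 =>
    ((hF.continuousAt (x := 0)).eventually_lt_const h0).filter_mono nhdsWithin_le_nhds
  have h1 := hlim (F := fun h => A * h) (r := 1) (by fun_prop) (by simp)
  have h2 := hlim (F := fun h => 20 * (c * (3 * h) ^ (κ - 1)) ^ 2) (r := 1)
    (((((Real.continuous_rpow_const hκ0.le).comp (continuous_const_mul 3)).const_mul c).pow 2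
      ).const_mul 20) (by simp [Real.zero_rpow hκ0.ne'])
  have h3 := hlim (F := fun h => b + h) (r := 1) (by fun_prop) (by simpa using hb)
  have h4 := hlim (F := fun h => Δ₀ + h) (r := b) (by fun_prop) (by simpa using hbΔ)
  have h5 := hlim (F := fun h => c * (b + 2 * h) ^ (κ - 1)) (r := 1 / 2)
    (((Real.continuous_rpow_const hκ0.le).comp (by fun_prop)).const_mul c) (by simpa using hcb)
  have h6 := hlim (F := fun h => C₃ * h ^ (κ' - (κ - 1)) / (2 * c * 2 ^ (κ - 1))) (r := 1)
    (((Real.continuous_rpow_const hκ'0.le).const_mul C₃).div_const _)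
    (by simp [Real.zero_rpow hκ'0.ne'])
  obtain ⟨h₀, hh₀, hsub⟩ := mem_nhdsGT_iff_exists_Ioc_subset.1
    (h1.and (h2.and (h3.and (h4.and (h5.and h6)))))
  have hmem := hsub (right_mem_Ioc.2 hh₀)
  refine ⟨h₀, hh₀, hmem.1.le, hmem.2.1.le, fun h hh => ?_⟩
  obtain ⟨-, -, i3, i4, i5, i6⟩ := hsub hh
  exact ⟨i3.le, by linarith, i5.le, i6.le⟩

end
end ActiveLearning

theorem theorem5 (d : ℕ) (hd : 2 ≤ d) (lam α c κ C₃ Δ₀ κ' : ℝ)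
    (hlam : 1 ≤ lam) (hα : 0 < α) (hc : 0 < c) (hκ : 1 < κ) (hκ' : κ - 1 < κ')
    (hC₃ : 0 < C₃) (hΔ₀ : 0 < Δ₀) (hΔ₀_lt : Δ₀ < 1)
    (hcΔ : c * (max (1 / 2) Δ₀) ^ (κ - 1) < 1 / 2) :
    ∃ C : ℝ, 0 < C ∧ ∃ N : ℕ, ∀ n : ℕ, N ≤ n →
      ENNReal.ofReal (C * (n : ℝ) ^ (-(α * κ') / (2 * α * (κ - 1) + (d : ℝ) - 1))) ≤
        ActiveLearning.minimaxRisk.{u} n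
          (ActiveLearning.problemClass d lam α c κ C₃ Δ₀ κ') := by
  obtain ⟨b, hb, hb1, hcb⟩ := ActiveLearning.exists_base_level hκ hΔ₀_lt hcΔ
  obtain ⟨hb12, hbΔ⟩ := max_lt_iff.1 hb
  obtain ⟨A, hA, hHolder⟩ := ActiveLearning.isHolder_bumpBoundary (d - 1) (α := α) hlam
  obtain ⟨h₀, hh₀, hA₀, hδ₀, hsmall⟩ :=
    ActiveLearning.exists_height (C₃ := C₃) (A := A) hκ hκ' hbΔ hb1 hcb
  have hκ0 : 0 < κ - 1 := by linarith
  have hκ'0 : 0 < κ' := by linarith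
  have hm : ((d - 1 : ℕ) : ℝ) = (d : ℝ) - 1 := by
    rw [Nat.cast_sub (by omega)]; simp
  set e : ℝ := 2 * α * (κ - 1) + (d : ℝ) - 1 with he
  have hd' : (2 : ℝ) ≤ d := by exact_mod_cast hd
  have he0 : 0 < e := by
    have : 0 < 2 * α * (κ - 1) := by positivity
    linarith
  -- The power of `2` pays for rounding `n^(1/e)` up to the integer `K`, which at most doubles it
  -- once `n ≥ 1`.
  refine ⟨3 / 16 * (C₃ * (h₀ ^ κ' * 2 ^ (-(α * κ')))), by positivity, 1, fun n hn => ?_⟩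
  have hn1 : (1 : ℝ) ≤ n := by exact_mod_cast hn
  have hroot1 : 1 ≤ (n : ℝ) ^ e⁻¹ := Real.one_le_rpow hn1 (by positivity)
  set K : ℕ := ⌈(n : ℝ) ^ e⁻¹⌉₊ with hKdef
  have hKge : (n : ℝ) ^ e⁻¹ ≤ K := Nat.le_ceil _
  have hKle : (K : ℝ) ≤ 2 * (n : ℝ) ^ e⁻¹ := by
    have := Nat.ceil_lt_add_one (zero_le_one.trans hroot1)
    linarith
  have hK1 : (1 : ℝ) ≤ K := hroot1.trans hKge
  have hK0 : (0 : ℝ) < K := by linarith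
  have hnK : (n : ℝ) ≤ (K : ℝ) ^ e := by
    calc (n : ℝ) = ((n : ℝ) ^ e⁻¹) ^ e := by
          rw [← Real.rpow_mul (by positivity), inv_mul_cancel₀ he0.ne', Real.rpow_one]
      _ ≤ _ := Real.rpow_le_rpow (by positivity) hKge he0.le
  set h : ℝ := h₀ * (K : ℝ) ^ (-α) with hh
  have hh_pos : 0 < h := by positivity
  have hh_le : h ≤ h₀ :=
    mul_le_of_le_one_right hh₀.le (Real.rpow_le_one_of_one_le_of_nonpos hK1 (by linarith))
  obtain ⟨hbh, hΔh, hnoise, hw1⟩ := hsmall h ⟨hh_pos, hh_le⟩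
  have hhK : h * (K : ℝ) ^ α = h₀ := by
    rw [hh, mul_assoc, ← Real.rpow_add hK0, neg_add_cancel, Real.rpow_zero, mul_one]
  let G : ActiveLearning.GridParam d lam α c κ C₃ Δ₀ κ' :=
    { K := K
      b := ⟨b, by linarith, hb1.le⟩
      h := h
      -- The solution of `mass_eq` for `w`.
      w := C₃ * h ^ (κ' - (κ - 1)) / (2 * c * 2 ^ (κ - 1))
      one_le_K := by exact_mod_cast hK1
      c_pos := hc
      one_lt_κ := hκ
      κ'_nonneg := hκ'0.le
      C₃_nonneg := hC₃.le
      half_le_b := hb12.le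
      h_pos := hh_pos
      Δ₀_lt := hΔh
      noise_le := hnoise
      w_nonneg := by positivity
      w_le_one := hw1
      mass_eq := by
        rw [Real.mul_rpow (by norm_num) hh_pos.le]
        have h1 : h ^ κ' = h ^ (κ' - (κ - 1)) * h ^ (κ - 1) := by
          rw [← Real.rpow_add hh_pos]; congr 1; ring
        rw [h1]
        field_simp
      isHolder := fun σ => hHolder K b h σ (by exact_mod_cast hK1) hh_pos.le (by linarith) hbh
        (by rw [mul_assoc, hhK]; exact hA₀) }
  refine le_trans (ENNReal.ofReal_le_ofReal ?_) (G.le_minimaxRisk (n := n) ?_)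
  · change _ ≤ 3 / 16 * (C₃ * h ^ κ')
    rw [mul_assoc, mul_assoc, mul_assoc]
    refine mul_le_mul_of_nonneg_left (mul_le_mul_of_nonneg_left ?_ hC₃.le) (by norm_num)
    rw [hh, Real.mul_rpow hh₀.le (by positivity), ← Real.rpow_mul hK0.le]
    refine mul_le_mul_of_nonneg_left ?_ (by positivity)
    have hneg : -(α * κ') ≤ 0 := by
      have : 0 < α * κ' := by positivity
      linarith
    calc (2 : ℝ) ^ (-(α * κ')) * (n : ℝ) ^ (-(α * κ') / e)
        = (2 * (n : ℝ) ^ e⁻¹) ^ (-(α * κ')) := by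
          rw [Real.mul_rpow (by norm_num) (by positivity), ← Real.rpow_mul (by positivity)]
          congr 2; ring
      _ ≤ (K : ℝ) ^ (-(α * κ')) := Real.rpow_le_rpow_of_nonpos hK0 hKle hneg
      _ = (K : ℝ) ^ (-α * κ') := by rw [neg_mul]
  · change 5 * (4 * (c * (3 * h) ^ (κ - 1)) ^ 2) * n ≤ (K : ℝ) ^ (d - 1)
    have h1 : (3 * h) ^ (κ - 1) = (3 * h₀) ^ (κ - 1) * (K : ℝ) ^ (-α * (κ - 1)) := by
      rw [hh, ← mul_assoc, Real.mul_rpow (by positivity) (by positivity), ← Real.rpow_mul hK0.le]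
    -- This balance determines the exponent: `e - 2α(κ - 1) = d - 1`.
    have h2 : ((K : ℝ) ^ (-α * (κ - 1))) ^ 2 * (K : ℝ) ^ e = (K : ℝ) ^ (d - 1) := by
      rw [← Real.rpow_natCast, ← Real.rpow_mul hK0.le, ← Real.rpow_add hK0, ← Real.rpow_natCast, hm]
      congr 1
      rw [he]; push_cast; ring
    calc 5 * (4 * (c * (3 * h) ^ (κ - 1)) ^ 2) * n
        = 20 * (c * (3 * h₀) ^ (κ - 1)) ^ 2 * (((K : ℝ) ^ (-α * (κ - 1))) ^ 2 * n) := by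
          rw [h1]; ring
      _ ≤ 1 * (((K : ℝ) ^ (-α * (κ - 1))) ^ 2 * (K : ℝ) ^ e) := by gcongr
      _ = (K : ℝ) ^ (d - 1) := by rw [one_mul, h2]
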